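/- Let $(M,g)$ be a compact $6$-dimensional smooth Riemannian manifold without boundary. Given constants $\alpha,\beta\in\mathbb R$, functions $R$ and $T_{string}$ on $M$, and differential $p$-forms $F_p$ ($0\le p\le 6$), with pointwise norms $|F_p|$ taken with respect to $g$, consider for positive functions $v,u$ on $M$ the system \begin{gather*} 10uv\,\Delta v+6\,\mathrm{div}(v^{2}\nabla u)-2uv^{2}R+u\sum_{p=0}^{6}v^{3-p}|F_p|^2-2uv^{(q-3)/2}T_{string}=2\alpha v^3,\\ 5\Delta(u^{2}v)+5u^{2}\Delta v-2u^{2}vR-6v|\nabla u|^{2}+\frac{u^2}{2}\sum_{p=0}^{6}(3-p)v^{2-p}|F_p|^2-\frac{q-3}{2}u^{2}v^{(q-5)/2}T_{string}=6\left[\alpha uv^2+\beta v^2\right]. \end{gather*} Let $q=3$ and $F_0=F_2=F_4=F_6\equiv0$; the remaining data then enter the system only through $\alpha$, $\beta$, $F_5$ and the two functions $2R-|F_1|^2$ and $|F_3|^2-2T_{string}$. Let $s>5$ be a real number. Then there is a neighbourhood $\mathcal N$ of $(1,1)$ in $H^s(M)\times H^s(M)$, and there are maps $$(\alpha,\beta,F_5,v,u)\mapsto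 a\in H^{s-2}(M),\qquad (\alpha,\beta,F_5,v,u)\mapsto b\in H^{s-2}(M),$$ defined and continuous for $\alpha,\beta\in\mathbb R$, $F_5$ in the space of $5$-forms of class $H^s$, and $(v,u)\in\mathcal N$ (with the $H^s$ topologies on $F_5,v,u$ and the $H^{s-2}$ topology on $a,b$), such that for all such $(\alpha,\beta,F_5,v,u)$ the functions $v,u$ are positive and of class $C^2$ and the system is satisfied pointwise on $M$ when $2R-|F_1|^2$ is replaced by $a$ and $|F_3|^2-2T_{string}$ by $b$. -/

import Mathlib

open Set MeasureTheory Topology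
open scoped Manifold ContDiff FourierTransform ENNReal

noncomputable section

/-- The model space `ℝ⁶`. -/
abbrev E6 : Type := EuclideanSpace ℝ (Fin 6)

/-- The standard basis of `ℝ⁶`. -/
def stdVec (i : Fin 6) : E6 := EuclideanSpace.single i (1 : ℝ)

/-! ### Sobolev spaces of real order -/

/-- `ξ ↦ (1 + |ξ|²)^{s/2} f̂(ξ)`. -/
def besselFourier (s : ℝ) (f : E6 → ℝ) (ξ : E6) : ℂ :=
  (((1 + ‖ξ‖ ^ 2) ^ (s / 2) : ℝ) : ℂ) * 𝓕 (fun y : E6 => (f y : ℂ)) ξ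

/-- Membership in `H^s(ℝ⁶)` of an integrable function `f` (it is used only for continuous functions
with compact support): `(1 + |ξ|²)^{s/2} f̂(ξ)` is square integrable. The `H^s` norm of `f` is the
`L²` norm of that function. -/
def MemHsEuclidean (s : ℝ) (f : E6 → ℝ) : Prop :=
  MemLp (besselFourier s f) 2 volume

section Manifold

variable (M : Type*) [TopologicalSpace M] [ChartedSpace E6 M]

/-- A localizer on `M`: a smooth chart `e` of `M` (any element of the maximal smooth atlas) together
with a smooth cut-off function `χ` with compact support in the image of `e`. -/
structure Localizer where
  chart : OpenPartialHomeomorph M E6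
  chart_mem : chart ∈ IsManifold.maximalAtlas (𝓡 6) ∞ M
  cutoff : E6 → ℝ
  smooth : ContDiff ℝ ∞ cutoff
  compact : HasCompactSupport cutoff
  support : tsupport cutoff ⊆ chart.target

variable {M}

/-- The localization `χ · (f ∘ e⁻¹)` of a function on `M`, extended by zero to `ℝ⁶`. -/
def Localizer.loc (l : Localizer M) (f : M → ℝ) (y : E6) : ℝ :=
  l.cutoff y * f (l.chart.symm y)

variable (M)

/-- The space `H^s(M)` of a compact 6-manifold: functions all of whose localizations are in
`H^s(ℝ⁶)`. Only `s > 3` is used. Then, by the Sobolev embedding, every element of `H^s(M)` has exactly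
one continuous representative, and it is this representative that is recorded. -/
structure HsFunction (s : ℝ) where
  toFun : M → ℝ
  continuous_toFun : Continuous toFun
  memHs : ∀ l : Localizer M, MemHsEuclidean s (l.loc toFun)

variable {M}

instance (s : ℝ) : CoeFun (HsFunction M s) (fun _ => M → ℝ) := ⟨HsFunction.toFun⟩

/-- The `H^s` topology: the coarsest one for which all localizations `f ↦ χ · (f ∘ e⁻¹)` are
continuous into `H^s(ℝ⁶)` with its norm. -/
instance (s : ℝ) : TopologicalSpace (HsFunction M s) :=
  ⨅ l : Localizer M, TopologicalSpace.induced
    (fun f : HsFunction M s => (f.memHs l).toLp (besselFourier s (l.loc f))) inferInstance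

/-- A smooth function with compact support is in every `H^s(ℝ⁶)`. -/
theorem memHsEuclidean_of_smooth (s : ℝ) {f : E6 → ℝ} (hf : ContDiff ℝ ∞ f)
    (hc : HasCompactSupport f) : MemHsEuclidean s f := by
  have h1 : HasCompactSupport (fun y : E6 => (f y : ℂ)) :=
    hc.comp_left (g := Complex.ofReal) Complex.ofReal_zero
  have h2 : ContDiff ℝ ∞ (fun y : E6 => (f y : ℂ)) := Complex.ofRealCLM.contDiff.comp hf
  set φ : SchwartzMap E6 ℂ := h1.toSchwartzMap h2 with hφ
  have h3 : Function.HasTemperateGrowth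
      (fun ξ : E6 => (((1 + ‖ξ‖ ^ 2) ^ (s / 2) : ℝ) : ℂ)) := by fun_prop
  have h4 := (SchwartzMap.smulLeftCLM ℂ (fun ξ : E6 => (((1 + ‖ξ‖ ^ 2) ^ (s / 2) : ℝ) : ℂ))
    (𝓕 φ)).memLp 2 (volume : Measure E6)
  have h5 : (SchwartzMap.smulLeftCLM ℂ (fun ξ : E6 => (((1 + ‖ξ‖ ^ 2) ^ (s / 2) : ℝ) : ℂ))
    (𝓕 φ) : E6 → ℂ) = besselFourier s f := by
    ext ξ
    rw [SchwartzMap.smulLeftCLM_apply_apply h3]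
    rfl
  rw [h5] at h4
  exact h4

/-- The constant function `1`, as an element of `H^s(M)`. -/
instance (s : ℝ) : One (HsFunction M s) where
  one :=
    { toFun := fun _ => 1
      continuous_toFun := continuous_const
      memHs := fun l => by
        have : l.loc (fun _ : M => (1 : ℝ)) = l.cutoff := by
          ext y; simp [Localizer.loc]
        rw [this]
        exact memHsEuclidean_of_smooth s l.smooth l.compact }

/-! ### Differential forms of class `H^s` -/

variable (M)

/-- Differential `p`-forms on `M` (no regularity). -/
abbrev DiffForm (p : ℕ) : Type _ :=
  (x : M) → TangentSpace (𝓡 6) x [⋀^Fin p]→L[ℝ] ℝ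

variable {M}

/-- The vector `∂_w` at `e⁻¹(y)`: the image under `d(e⁻¹)` of the vector `w ∈ ℝ⁶`. -/
def chartVec (e : OpenPartialHomeomorph M E6) (y w : E6) : TangentSpace (𝓡 6) (e.symm y) :=
  mfderiv (𝓡 6) (𝓡 6) e.symm y w

/-- The component `F(∂_{w₁}, …, ∂_{w_p})` in the chart `e`, as a function on `e.target`. -/
def DiffForm.comp {p : ℕ} (F : DiffForm M p) (e : OpenPartialHomeomorph M E6)
    (w : Fin p → E6) (y : E6) : ℝ :=
  F (e.symm y) (fun k => chartVec e y (w k))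

/-- The localized component `χ · F(∂_{w₁}, …, ∂_{w_p})`. -/
def Localizer.locForm {p : ℕ} (l : Localizer M) (w : Fin p → E6) (F : DiffForm M p) (y : E6) : ℝ :=
  l.cutoff y * F.comp l.chart w y

variable (M)

/-- The space of `p`-forms of class `H^s` (used for `s > 3`, through continuous representatives):
the components in all charts, cut off, are in `H^s(ℝ⁶)`. -/
structure HsForm (p : ℕ) (s : ℝ) where
  toForm : DiffForm M p
  continuousOn_comp : ∀ e ∈ IsManifold.maximalAtlas (𝓡 6) ∞ M, ∀ w : Fin p → E6,
    ContinuousOn (toForm.comp e w) e.target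
  memHs : ∀ (l : Localizer M) (w : Fin p → E6), MemHsEuclidean s (l.locForm w toForm)

variable {M}

/-- The `H^s` topology on `p`-forms. -/
instance (p : ℕ) (s : ℝ) : TopologicalSpace (HsForm M p s) :=
  ⨅ (l : Localizer M) (w : Fin p → E6), TopologicalSpace.induced
    (fun F : HsForm M p s => (F.memHs l w).toLp (besselFourier s (l.locForm w F.toForm)))
    inferInstance

/-! ### Riemannian geometry -/

variable [IsManifold (𝓡 6) ∞ M]

variable (M) in
/-- Smooth Riemannian metrics on `M`. -/
abbrev SmoothMetric : Type _ :=
  Bundle.ContMDiffRiemannianMetric (𝓡 6) ∞ E6 (fun x : M => TangentSpace (𝓡 6) x)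

/-- The Gram matrix of `g` in the standard basis of `T_xM` (which is by definition a copy of
`ℝ⁶`). The two definitions below that use it do not depend on the basis. -/
def gramAt (g : SmoothMetric M) (x : M) : Matrix (Fin 6) (Fin 6) ℝ :=
  Matrix.of fun i j => g.inner x (stdVec i : TangentSpace (𝓡 6) x) (stdVec j : TangentSpace (𝓡 6) x)

/-- The differential of a real function at `x`, as a linear form on `T_xM`. -/
def dReal (f : M → ℝ) (x : M) : TangentSpace (𝓡 6) x →L[ℝ] ℝ :=
  mfderiv (𝓡 6) 𝓘(ℝ, ℝ) f x

/-- The gradient `∇f = g^{ij} (∂_j f) ∂_i`. -/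
def grad (g : SmoothMetric M) (f : M → ℝ) (x : M) : TangentSpace (𝓡 6) x :=
  ∑ i, ∑ j, ((gramAt g x)⁻¹ i j * dReal f x (stdVec j)) •
    (stdVec i : TangentSpace (𝓡 6) x)

/-- The pointwise norm squared of a `p`-form,
`|F|² = (1/p!) g^{i₁j₁} ⋯ g^{i_pj_p} F_{i₁…i_p} F_{j₁…j_p}`. -/
def formNormSq {p : ℕ} (g : SmoothMetric M) (F : DiffForm M p) (x : M) : ℝ :=
  (1 / (p.factorial : ℝ)) * ∑ i : Fin p → Fin 6, ∑ j : Fin p → Fin 6,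
    (∏ k, (gramAt g x)⁻¹ (i k) (j k)) * F x (fun k => stdVec (i k)) * F x (fun k => stdVec (j k))

/-- The matrix `g_{ij} = g(∂_i, ∂_j)` of the metric in the chart `e`. -/
def chartGram (g : SmoothMetric M) (e : OpenPartialHomeomorph M E6) (y : E6) :
    Matrix (Fin 6) (Fin 6) ℝ :=
  Matrix.of fun i j => g.inner (e.symm y) (chartVec e y (stdVec i)) (chartVec e y (stdVec j))

/-- The component `X^i` of a vector field in the chart `e`. -/
def chartCoord (e : OpenPartialHomeomorph M E6) (X : (x : M) → TangentSpace (𝓡 6) x)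
    (i : Fin 6) (y : E6) : ℝ :=
  (show E6 from mfderiv (𝓡 6) (𝓡 6) e (e.symm y) (X (e.symm y))) i

/-- The divergence in the chart `e`: `∂_i X^i + Γ^i_{ik} X^k` with
`Γ^i_{ik} = ½ g^{ij} ∂_k g_{ij} = ∂_k log √(det g)`, that is,
`(det g)^{-1/2} ∂_i ((det g)^{1/2} X^i)`. -/
def chartDiv (g : SmoothMetric M) (e : OpenPartialHomeomorph M E6)
    (X : (x : M) → TangentSpace (𝓡 6) x) (y : E6) : ℝ :=
  (∑ i, fderiv ℝ (chartCoord e X i) y (stdVec i)) +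
    ∑ k, (1 / 2 * ∑ i, ∑ j, (chartGram g e y)⁻¹ i j *
      fderiv ℝ (fun z => chartGram g e z i j) y (stdVec k)) * chartCoord e X k y

/-- The divergence of a vector field at `x`, computed in the preferred chart at `x` (for
differentiable fields the value does not depend on the chart). -/
def diverg (g : SmoothMetric M) (X : (x : M) → TangentSpace (𝓡 6) x) (x : M) : ℝ :=
  chartDiv g (chartAt E6 x) X (chartAt E6 x x)

/-- The Laplace–Beltrami operator `Δf = div ∇f`. -/
def lap (g : SmoothMetric M) (f : M → ℝ) (x : M) : ℝ :=
  diverg g (grad g f) x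

/-! ### The equations of motion -/

/-- `(v, u)` is a (classical, positive) solution of the equations of motion with parameters
`L, q`, Lagrange multipliers `α, β`, scalar curvature term `R`, fluxes `F_0, …, F_L` and string
term `T`. -/
structure SolvesEqMotion (g : SmoothMetric M) (L : ℕ) (q : ℤ) (α β : ℝ) (R : M → ℝ)
    (F : (p : ℕ) → DiffForm M p) (T : M → ℝ) (v u : M → ℝ) : Prop where
  contMDiff_v : ContMDiff (𝓡 6) 𝓘(ℝ, ℝ) 2 v
  contMDiff_u : ContMDiff (𝓡 6) 𝓘(ℝ, ℝ) 2 u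
  v_pos : ∀ x, 0 < v x
  u_pos : ∀ x, 0 < u x
  eq_u : ∀ x,
    10 * u x * v x * lap g v x + 6 * diverg g (fun z => v z ^ 2 • grad g u z) x
      - 2 * u x * v x ^ 2 * R x
      + u x * ∑ p ∈ Finset.range (L + 1), v x ^ (3 - (p : ℤ)) * formNormSq g (F p) x
      - 2 * u x * v x ^ (((q : ℝ) - 3) / 2) * T x
    = 2 * α * v x ^ 3
  eq_v : ∀ x,
    5 * lap g (fun z => u z ^ 2 * v z) x + 5 * u x ^ 2 * lap g v x
      - 2 * u x ^ 2 * v x * R x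
      - 6 * v x * g.inner x (grad g u x) (grad g u x)
      + u x ^ 2 / 2 * ∑ p ∈ Finset.range (L + 1),
          (3 - (p : ℝ)) * v x ^ (2 - (p : ℤ)) * formNormSq g (F p) x
      - ((q : ℝ) - 3) / 2 * u x ^ 2 * v x ^ (((q : ℝ) - 5) / 2) * T x
    = 6 * (α * u x * v x ^ 2 + β * v x ^ 2)

end Manifold

end

noncomputable section

/-!
For `q = 3` and `F₀ = F₂ = F₄ = F₆ = 0` the system is linear and triangular in the data: the second
equation determines `a = 2R - |F₁|²` and, `a` being known, the first one determines
`b = |F₃|² - 2T`. Both are polynomials in `α`, `β`, `u`, `v`, `u⁻¹`, `v⁻¹`, the metric coefficients,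
the components of `F₅` and at most two derivatives of `u`, `v`.

So everything rests on `H^σ` being a multiplicative algebra of continuous functions for
`σ > dim / 2`, here with `σ = s - 2 > 3`, in which positive functions can be inverted, continuously.
A function of class `H^σ` is handled through its `L²` density `(1 + |ξ|²)^{σ/2} f̂`, and the product
is the twisted convolution of densities. Inversion comes from Gelfand theory: the characters of the
non-unital algebra `H^σ` are point evaluations, so `1 + f` is invertible as soon as it has no zero.

The divergence is defined by a preferred chart at each point. Since it does not depend on the chart
for differentiable fields, it can be read in a fixed chart near any point, where it is a
differential operator with smooth coefficients.
-/

/-! ### Young's inequality -/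

section Young

variable {G : Type*} [MeasurableSpace G] {μ : Measure G}

lemma rpow_lintegral_mul_le {p : ℝ} (hp : 1 ≤ p) {a b : G → ℝ≥0∞} (ha : AEMeasurable a μ)
    (hb : AEMeasurable b μ) :
    (∫⁻ x, a x * b x ∂μ) ^ p ≤ (∫⁻ x, a x ∂μ) ^ (p - 1) * ∫⁻ x, a x * b x ^ p ∂μ := by
  have hp0 : 0 < p := one_pos.trans_le hp
  have jensen := eLpNorm'_le_eLpNorm'_mul_rpow_measure_univ one_pos hp
    (hb.mono_ac (withDensity_absolutelyContinuous μ a)).aestronglyMeasurable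
  simp only [eLpNorm', enorm_eq_self, ENNReal.rpow_one, div_one,
    withDensity_apply _ MeasurableSet.univ, Measure.restrict_univ,
    lintegral_withDensity_eq_lintegral_mul₀ ha hb,
    lintegral_withDensity_eq_lintegral_mul₀ ha (hb.pow_const p), Pi.mul_apply] at jensen
  calc (∫⁻ x, a x * b x ∂μ) ^ p
      ≤ ((∫⁻ x, a x * b x ^ p ∂μ) ^ (1 / p) * (∫⁻ x, a x ∂μ) ^ (1 - 1 / p)) ^ p :=
        ENNReal.rpow_le_rpow jensen hp0.le
    _ = (∫⁻ x, a x ∂μ) ^ (p - 1) * ∫⁻ x, a x * b x ^ p ∂μ := by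
        rw [ENNReal.mul_rpow_of_nonneg _ _ hp0.le, ← ENNReal.rpow_mul, ← ENNReal.rpow_mul,
          one_div_mul_cancel hp0.ne', ENNReal.rpow_one, sub_mul, one_mul,
          one_div_mul_cancel hp0.ne', mul_comm]

variable [AddGroup G] [MeasurableAdd₂ G] [MeasurableNeg G] [μ.IsAddLeftInvariant] [SFinite μ]

lemma lintegral_lconvolution_rpow_le {p : ℝ} (hp : 1 ≤ p) {a b : G → ℝ≥0∞}
    (ha : AEMeasurable a μ) (hb : AEMeasurable b μ) :
    ∫⁻ x, (a ⋆ₗ[μ] b) x ^ p ∂μ ≤ (∫⁻ x, a x ∂μ) ^ p * ∫⁻ x, b x ^ p ∂μ := by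
  have hbp : AEMeasurable (fun q : G × G => b (-q.2 + q.1)) (μ.prod μ) := by fun_prop
  calc ∫⁻ x, (a ⋆ₗ[μ] b) x ^ p ∂μ
      ≤ ∫⁻ x, (∫⁻ y, a y ∂μ) ^ (p - 1) * ∫⁻ y, a y * b (-y + x) ^ p ∂μ ∂μ :=
        lintegral_mono fun x => rpow_lintegral_mul_le hp ha (by fun_prop)
    _ = (∫⁻ y, a y ∂μ) ^ (p - 1) * ∫⁻ x, ∫⁻ y, a y * b (-y + x) ^ p ∂μ ∂μ :=
        lintegral_const_mul'' _
          ((ha.comp_snd.mul (hbp.pow_const p)).lintegral_prod_right')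
    _ = (∫⁻ y, a y ∂μ) ^ (p - 1) * ∫⁻ y, ∫⁻ x, a y * b (-y + x) ^ p ∂μ ∂μ := by
        rw [lintegral_lintegral_swap (ha.comp_snd.mul (hbp.pow_const p))]
    _ = (∫⁻ y, a y ∂μ) ^ (p - 1) * ∫⁻ y, a y * ∫⁻ x, b x ^ p ∂μ ∂μ := by
        congr 1
        refine lintegral_congr fun y => ?_
        have hby : AEMeasurable (fun x => b (-y + x)) μ :=
          hb.comp_quasiMeasurePreserving
            (measurePreserving_add_left μ (-y)).quasiMeasurePreserving
        rw [lintegral_const_mul'' _ (hby.pow_const p),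
          lintegral_add_left_eq_self (fun x => b x ^ p) (-y)]
    _ = (∫⁻ y, a y ∂μ) ^ p * ∫⁻ x, b x ^ p ∂μ := by
        rw [lintegral_mul_const'' _ ha, ← mul_assoc]
        nth_rw 2 [← ENNReal.rpow_one (∫⁻ y, a y ∂μ)]
        rw [← ENNReal.rpow_add_of_nonneg _ _ (sub_nonneg.2 hp) zero_le_one, sub_add_cancel]

lemma eLpNorm_lconvolution_le {p : ℝ≥0∞} (hp : 1 ≤ p) (hp' : p ≠ ⊤) {a b : G → ℝ≥0∞}
    (ha : AEMeasurable a μ) (hb : AEMeasurable b μ) :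
    eLpNorm (a ⋆ₗ[μ] b) p μ ≤ (∫⁻ x, a x ∂μ) * eLpNorm b p μ := by
  have hp1 : 1 ≤ p.toReal := by simpa using ENNReal.toReal_mono hp' hp
  have hp0 : 0 < p.toReal := one_pos.trans_le hp1
  have hp_ne : p ≠ 0 := (one_pos.trans_le hp).ne'
  rw [eLpNorm_eq_lintegral_rpow_enorm_toReal hp_ne hp',
    eLpNorm_eq_lintegral_rpow_enorm_toReal hp_ne hp']
  simp only [enorm_eq_self]
  refine (ENNReal.rpow_le_rpow (lintegral_lconvolution_rpow_le hp1 ha hb)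
    (one_div_nonneg.2 hp0.le)).trans_eq ?_
  rw [ENNReal.mul_rpow_of_nonneg _ _ (one_div_nonneg.2 hp0.le), ← ENNReal.rpow_mul,
    mul_one_div_cancel hp0.ne', ENNReal.rpow_one]

end Young

/-! ### The Bessel weight -/

section BesselWeight

variable {V : Type*} [NormedAddCommGroup V]

/-- The weight `(1 + |ξ|²)^{σ/2}` that measures regularity of order `σ` on the Fourier side. -/
def besselWeight (σ : ℝ) (ξ : V) : ℝ := (1 + ‖ξ‖ ^ 2) ^ (σ / 2)

lemma besselWeight_pos (σ : ℝ) (ξ : V) : 0 < besselWeight σ ξ :=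
  Real.rpow_pos_of_pos (by positivity) _

lemma norm_ofReal_besselWeight (σ : ℝ) (ξ : V) : ‖(besselWeight σ ξ : ℂ)‖ = besselWeight σ ξ := by
  rw [Complex.norm_real, Real.norm_of_nonneg (besselWeight_pos σ ξ).le]

@[fun_prop]
lemma continuous_besselWeight (σ : ℝ) : Continuous (besselWeight σ : V → ℝ) :=
  Continuous.rpow_const (by fun_prop) fun ξ => Or.inl (by positivity)

lemma besselWeight_mul (σ τ : ℝ) (ξ : V) :
    besselWeight σ ξ * besselWeight τ ξ = besselWeight (σ + τ) ξ := by
  rw [besselWeight, besselWeight, besselWeight, ← Real.rpow_add (by positivity), add_div]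

lemma besselWeight_zero (ξ : V) : besselWeight 0 ξ = 1 := by simp [besselWeight]

lemma besselWeight_mono {σ τ : ℝ} (h : σ ≤ τ) (ξ : V) : besselWeight σ ξ ≤ besselWeight τ ξ :=
  Real.rpow_le_rpow_of_exponent_le (by simp) (by linarith)

lemma norm_pow_le_besselWeight (n : ℕ) (ξ : V) : ‖ξ‖ ^ n ≤ besselWeight n ξ := by
  rw [besselWeight, Real.rpow_div_two_eq_sqrt _ (by positivity), Real.rpow_natCast]
  exact pow_le_pow_left₀ (norm_nonneg ξ) (Real.le_sqrt_of_sq_le (by linarith)) n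

lemma besselWeight_add_le {σ : ℝ} (hσ : 0 ≤ σ) (ξ η : V) :
    besselWeight σ (ξ + η) ≤ 4 ^ (σ / 2) * (besselWeight σ ξ + besselWeight σ η) := by
  wlog h : ‖η‖ ≤ ‖ξ‖ generalizing ξ η
  · rw [add_comm ξ, add_comm (besselWeight σ ξ)]
    exact this η ξ (le_of_not_ge h)
  have norm_add_sq_le : 1 + ‖ξ + η‖ ^ 2 ≤ 4 * (1 + ‖ξ‖ ^ 2) := by
    have : ‖ξ + η‖ ≤ 2 * ‖ξ‖ := by linarith [norm_add_le ξ η]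
    nlinarith [norm_nonneg (ξ + η)]
  calc besselWeight σ (ξ + η)
      ≤ (4 * (1 + ‖ξ‖ ^ 2)) ^ (σ / 2) :=
        Real.rpow_le_rpow (by positivity) norm_add_sq_le (by linarith)
    _ = 4 ^ (σ / 2) * besselWeight σ ξ := Real.mul_rpow (by norm_num) (by positivity)
    _ ≤ 4 ^ (σ / 2) * (besselWeight σ ξ + besselWeight σ η) := by
        gcongr
        exact le_add_of_nonneg_right (besselWeight_pos σ η).le

/-- Multiplication by the weight `(1 + |ξ|²)^{σ/2}`: the Fourier side of `(1 - Δ/4π²)^{σ/2}`. -/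
def besselMul (σ : ℝ) (f : V → ℂ) (ξ : V) : ℂ := besselWeight σ ξ * f ξ

lemma besselMul_besselMul (σ τ : ℝ) (f : V → ℂ) :
    besselMul σ (besselMul τ f) = besselMul (σ + τ) f := by
  ext ξ
  rw [besselMul, besselMul, besselMul, ← mul_assoc, ← Complex.ofReal_mul, besselWeight_mul]

lemma besselMul_zero (f : V → ℂ) : besselMul 0 f = f := by
  ext ξ
  rw [besselMul, besselWeight_zero, Complex.ofReal_one, one_mul]

lemma besselMul_neg_besselMul (σ : ℝ) (f : V → ℂ) : besselMul (-σ) (besselMul σ f) = f := by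
  rw [besselMul_besselMul, neg_add_cancel, besselMul_zero]

lemma besselMul_besselMul_neg (σ : ℝ) (f : V → ℂ) : besselMul σ (besselMul (-σ) f) = f := by
  rw [besselMul_besselMul, add_neg_cancel, besselMul_zero]

lemma enorm_besselMul (σ : ℝ) (f : V → ℂ) (ξ : V) :
    ‖besselMul σ f ξ‖ₑ = ENNReal.ofReal (besselWeight σ ξ) * ‖f ξ‖ₑ := by
  rw [besselMul, enorm_mul, ← ofReal_norm (besselWeight σ ξ : ℂ), norm_ofReal_besselWeight]

lemma besselMul_congr_ae {_ : MeasurableSpace V} {μ : Measure V} (σ : ℝ) {f f' : V → ℂ}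
    (h : f =ᵐ[μ] f') : besselMul σ f =ᵐ[μ] besselMul σ f' :=
  h.mono fun ξ hξ => by rw [besselMul, besselMul, hξ]

end BesselWeight

/-! ### Functions synthesized from their weighted Fourier transform -/

section Synthesis

variable {V : Type*} [NormedAddCommGroup V] [InnerProductSpace ℝ V]

lemma hasTemperateGrowth_besselWeight (σ : ℝ) :
    Function.HasTemperateGrowth fun ξ : V => (besselWeight σ ξ : ℂ) := by
  unfold besselWeight
  fun_prop

lemma exists_schwartz_eq_besselMul (σ : ℝ) (φ : SchwartzMap V ℂ) :
    ∃ ψ : SchwartzMap V ℂ, (ψ : V → ℂ) = besselMul σ φ :=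
  ⟨SchwartzMap.smulLeftCLM ℂ (fun ξ : V => (besselWeight σ ξ : ℂ)) φ, funext fun ξ => by
    rw [SchwartzMap.smulLeftCLM_apply_apply (hasTemperateGrowth_besselWeight σ), smul_eq_mul,
      besselMul]⟩

variable [FiniteDimensional ℝ V] [MeasurableSpace V] [BorelSpace V]

lemma integral_fourier_mul_eq_integral_mul_fourier {f g : V → ℂ} (hf : Integrable f)
    (hg : Integrable g) : ∫ ξ, 𝓕 f ξ * g ξ = ∫ x, f x * 𝓕 g x := by
  have h := VectorFourier.integral_fourierIntegral_smul_eq_flip (L := innerₗ V)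
    (μ := (volume : Measure V)) (ν := (volume : Measure V)) Real.continuous_fourierChar
    continuous_inner hf hg
  rwa [flip_innerₗ] at h

lemma integral_fourier_fourierInv_mul_schwartz {h : V → ℂ} (hh : Integrable h)
    (hf : Integrable (𝓕⁻ h)) (ψ : SchwartzMap V ℂ) : ∫ x, 𝓕 (𝓕⁻ h) x * ψ x = ∫ x, h x * ψ x := by
  have fourierInv_fourier_ψ : 𝓕⁻ (𝓕 (ψ : V → ℂ)) = ψ :=
    ψ.continuous.fourierInv_fourier_eq ψ.integrable (𝓕 ψ).integrable
  have integrable_fourier_ψ_neg : Integrable fun x => 𝓕 (ψ : V → ℂ) (-x) :=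
    ((𝓕 ψ).integrable (μ := volume)).comp_neg
  calc ∫ x, 𝓕 (𝓕⁻ h) x * ψ x
      = ∫ x, 𝓕⁻ h x * 𝓕 (ψ : V → ℂ) x :=
        integral_fourier_mul_eq_integral_mul_fourier hf ψ.integrable
    _ = ∫ x, 𝓕 h x * 𝓕 (ψ : V → ℂ) (-x) := by
        rw [← integral_neg_eq_self]
        simp only [Real.fourierInv_eq_fourier_neg, neg_neg]
    _ = ∫ x, h x * 𝓕 (fun y => 𝓕 (ψ : V → ℂ) (-y)) x :=
        integral_fourier_mul_eq_integral_mul_fourier hh integrable_fourier_ψ_neg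
    _ = ∫ x, h x * ψ x := by
        rw [← Real.fourierInv_eq_fourier_comp_neg, fourierInv_fourier_ψ]

lemma fourier_fourierInv_ae_eq {h : V → ℂ} (hh : Integrable h) (hf : Integrable (𝓕⁻ h)) :
    𝓕 (𝓕⁻ h) =ᵐ[volume] h := by
  have hcont : Continuous (𝓕 (𝓕⁻ h)) :=
    VectorFourier.fourierIntegral_continuous Real.continuous_fourierChar continuous_inner hf
  refine ae_eq_of_integral_contDiff_smul_eq hcont.locallyIntegrable hh.locallyIntegrable
    fun φ hφ hc => ?_
  have hc' : HasCompactSupport fun y => (φ y : ℂ) := hc.comp_left Complex.ofReal_zero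
  have key := integral_fourier_fourierInv_mul_schwartz hh hf
    (hc'.toSchwartzMap (Complex.ofRealCLM.contDiff.comp hφ))
  simp only [Complex.real_smul, mul_comm (φ _ : ℂ)]
  exact key

lemma ae_eq_zero_of_fourierInv_eq_zero {h : V → ℂ} (hh : Integrable h) (hf : 𝓕⁻ h = 0) :
    h =ᵐ[volume] 0 := by
  have inversion := fourier_fourierInv_ae_eq hh (by rw [hf]; exact integrable_zero _ _ _)
  refine inversion.symm.trans (Filter.Eventually.of_forall fun x => ?_)
  simp [hf, Real.fourier_eq]

variable {σ : ℝ}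

lemma memLp_two_besselWeight_neg (hσ : (Module.finrank ℝ V : ℝ) < 2 * σ) :
    MemLp (fun ξ : V => (besselWeight (-σ) ξ : ℂ)) 2 volume := by
  have hc : Continuous fun ξ : V => (besselWeight (-σ) ξ : ℂ) := by fun_prop
  rw [memLp_two_iff_integrable_sq_norm hc.aestronglyMeasurable]
  refine (integrable_rpow_neg_one_add_norm_sq hσ).congr (Filter.Eventually.of_forall fun ξ => ?_)
  simp only [norm_ofReal_besselWeight, sq (besselWeight _ _), besselWeight_mul]
  rw [besselWeight]
  ring_nf

lemma integrable_besselMul_neg (hσ : (Module.finrank ℝ V : ℝ) < 2 * σ) {g : V → ℂ}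
    (hg : MemLp g 2 volume) : Integrable (besselMul (-σ) g) :=
  (memLp_two_besselWeight_neg hσ).integrable_mul hg

lemma lintegral_enorm_besselMul_neg_le (σ : ℝ) {g : V → ℂ} (hg : AEStronglyMeasurable g volume) :
    ∫⁻ ξ, ‖besselMul (-σ) g ξ‖ₑ
      ≤ eLpNorm (fun ξ : V => (besselWeight (-σ) ξ : ℂ)) 2 volume * eLpNorm g 2 volume := by
  have hc : Continuous fun ξ : V => (besselWeight (-σ) ξ : ℂ) := by fun_prop
  calc ∫⁻ ξ, ‖besselMul (-σ) g ξ‖ₑ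
      = eLpNorm ((fun ξ : V => (besselWeight (-σ) ξ : ℂ)) • g) 1 volume :=
        eLpNorm_one_eq_lintegral_enorm.symm
    _ ≤ _ := eLpNorm_smul_le_mul_eLpNorm hg hc.aestronglyMeasurable

variable (V) in
/-- The square integrable densities: `g` stands for the function with Fourier transform
`(1 + |ξ|²)^{-σ/2} g(ξ)`, so that the `L²` norm of `g` is the `H^σ` norm of that function. -/
abbrev Density : Type _ := Lp ℂ 2 (volume : Measure V)

/-- Multiplication by `(1 + |ξ|²)^{-σ/2}`, which maps `L²` to `L¹` by the Cauchy–Schwarz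
inequality. -/
def besselToL1 (hσ : (Module.finrank ℝ V : ℝ) < 2 * σ) :
    Density V →L[ℂ] Lp ℂ 1 (volume : Measure V) :=
  (ContinuousLinearMap.mul ℂ ℂ).holderL volume 2 2 1 ((memLp_two_besselWeight_neg hσ).toLp _)

lemma coeFn_besselToL1 (hσ : (Module.finrank ℝ V : ℝ) < 2 * σ) (g : Density V) :
    besselToL1 hσ g =ᵐ[volume] besselMul (-σ) g := by
  filter_upwards [ContinuousLinearMap.coeFn_holder (r := 1) (ContinuousLinearMap.mul ℂ ℂ)
    ((memLp_two_besselWeight_neg hσ).toLp _) g, (memLp_two_besselWeight_neg hσ).coeFn_toLp]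
    with ξ h_holder h_weight
  exact h_holder.trans (by rw [h_weight]; rfl)

/-- The bounded continuous function of class `H^σ` with density `g`; its existence is the Sobolev
embedding theorem. -/
def synth (hσ : (Module.finrank ℝ V : ℝ) < 2 * σ) :
    Density V →L[ℂ] BoundedContinuousFunction V ℂ :=
  (Real.Lp.fourierTransformInvCLM V ℂ).comp (besselToL1 hσ)

lemma coe_synth (hσ : (Module.finrank ℝ V : ℝ) < 2 * σ) (g : Density V) :
    (synth hσ g : V → ℂ) = 𝓕⁻ (besselMul (-σ) g) := by
  ext x
  simp only [synth, ContinuousLinearMap.comp_apply, Real.Lp.fourierTransformInvCLM_apply,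
    Real.Lp.fourierTransformInv_apply]
  exact Real.fourierInv_congr_ae (coeFn_besselToL1 hσ g) x

lemma coe_synth_of_ae_eq (hσ : (Module.finrank ℝ V : ℝ) < 2 * σ) {g : Density V} {f : V → ℂ}
    (h : g =ᵐ[volume] f) : (synth hσ g : V → ℂ) = 𝓕⁻ (besselMul (-σ) f) := by
  rw [coe_synth]
  exact funext (Real.fourierInv_congr_ae (besselMul_congr_ae (-σ) h))

lemma synth_injective (hσ : (Module.finrank ℝ V : ℝ) < 2 * σ) :
    Function.Injective (synth hσ) := by
  refine (injective_iff_map_eq_zero _).2 fun g hg => ?_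
  have damped_eq_zero := ae_eq_zero_of_fourierInv_eq_zero
    (integrable_besselMul_neg hσ (Lp.memLp g)) (by rw [← coe_synth hσ, hg]; rfl)
  rw [Lp.eq_zero_iff_ae_eq_zero, ← besselMul_besselMul_neg σ g]
  filter_upwards [damped_eq_zero] with ξ hξ
  rw [besselMul, hξ, Pi.zero_apply, mul_zero]

lemma exists_synth_eq_schwartz (hσ : (Module.finrank ℝ V : ℝ) < 2 * σ) (f : SchwartzMap V ℂ) :
    ∃ g, ∀ y, synth hσ g y = f y := by
  obtain ⟨ψ, hψ⟩ := exists_schwartz_eq_besselMul σ (𝓕 f)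
  refine ⟨ψ.toLp 2, fun y => ?_⟩
  rw [coe_synth_of_ae_eq hσ (ψ.coeFn_toLp 2 volume), hψ, besselMul_neg_besselMul]
  exact congrFun (f.continuous.fourierInv_fourier_eq f.integrable (𝓕 f).integrable) y

lemma exists_synth_eq_of_contDiff (hσ : (Module.finrank ℝ V : ℝ) < 2 * σ) {f : V → ℂ}
    (hf : ContDiff ℝ ∞ f) (hc : HasCompactSupport f) : ∃ g, ∀ y, synth hσ g y = f y :=
  exists_synth_eq_schwartz hσ (hc.toSchwartzMap hf)

lemma dense_synth_schwartz (hσ : (Module.finrank ℝ V : ℝ) < 2 * σ) :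
    Dense {g : Density V | ∃ f : SchwartzMap V ℂ, ∀ y, synth hσ g y = f y} := by
  refine (SchwartzMap.denseRange_toLpCLM (p := 2) (by norm_num)).mono ?_
  rintro _ ⟨φ, rfl⟩
  obtain ⟨ψ, hψ⟩ := exists_schwartz_eq_besselMul (-σ) φ
  refine ⟨𝓕⁻ ψ, fun y => ?_⟩
  rw [SchwartzMap.fourierInv_coe, hψ]
  exact congrFun (coe_synth_of_ae_eq hσ (φ.coeFn_toLp 2 volume)) y

end Synthesis

/-! ### Comparison with the definition of `H^σ(ℝ⁶)` -/

section Comparison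

variable {σ : ℝ} {f : E6 → ℝ}

lemma besselFourier_eq_besselMul (σ : ℝ) (f : E6 → ℝ) :
    besselFourier σ f = besselMul σ (𝓕 fun y => (f y : ℂ)) := rfl

lemma synth_toLp_besselFourier (hσ : (Module.finrank ℝ E6 : ℝ) < 2 * σ) (hf : Continuous f)
    (hc : HasCompactSupport f) (h : MemHsEuclidean σ f) (y : E6) :
    synth hσ (h.toLp (besselFourier σ f)) y = f y := by
  have hfc : Continuous fun y => (f y : ℂ) := Complex.continuous_ofReal.comp hf
  have hint : Integrable fun y => (f y : ℂ) :=
    hfc.integrable_of_hasCompactSupport (hc.comp_left Complex.ofReal_zero)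
  have damped_eq : besselMul (-σ) (besselFourier σ f) = 𝓕 fun y => (f y : ℂ) := by
    rw [besselFourier_eq_besselMul, besselMul_neg_besselMul]
  have hFint : Integrable (𝓕 fun y => (f y : ℂ)) := damped_eq ▸ integrable_besselMul_neg hσ h
  rw [coe_synth_of_ae_eq hσ h.coeFn_toLp, damped_eq]
  exact congrFun (hfc.fourierInv_fourier_eq hint hFint) y

lemma besselFourier_ae_eq_of_synth (hσ : (Module.finrank ℝ E6 : ℝ) < 2 * σ)
    (hc : HasCompactSupport f) {g : Density E6} (h : ∀ y, synth hσ g y = f y) :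
    besselFourier σ f =ᵐ[volume] g := by
  have hfc : Continuous fun y => (f y : ℂ) := funext h ▸ (synth hσ g).continuous
  have fourierInv_damped : 𝓕⁻ (besselMul (-σ) g) = fun y => (f y : ℂ) := by
    rw [← coe_synth hσ, funext h]
  have inversion := fourier_fourierInv_ae_eq (integrable_besselMul_neg hσ (Lp.memLp g)) <| by
    rw [fourierInv_damped]
    exact hfc.integrable_of_hasCompactSupport (hc.comp_left Complex.ofReal_zero)
  rw [fourierInv_damped] at inversion
  rw [besselFourier_eq_besselMul, ← besselMul_besselMul_neg σ g]
  exact besselMul_congr_ae σ inversion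

lemma memHsEuclidean_of_synth (hσ : (Module.finrank ℝ E6 : ℝ) < 2 * σ)
    (hc : HasCompactSupport f) {g : Density E6} (h : ∀ y, synth hσ g y = f y) :
    MemHsEuclidean σ f :=
  (memLp_congr_ae (besselFourier_ae_eq_of_synth hσ hc h)).2 (Lp.memLp g)

lemma toLp_besselFourier_eq_of_synth (hσ : (Module.finrank ℝ E6 : ℝ) < 2 * σ)
    (hc : HasCompactSupport f) {g : Density E6} (h : ∀ y, synth hσ g y = f y)
    (hm : MemHsEuclidean σ f) : hm.toLp (besselFourier σ f) = g :=
  Lp.ext (hm.coeFn_toLp.trans (besselFourier_ae_eq_of_synth hσ hc h))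

end Comparison

/-! ### The product estimate -/

section Product

open scoped Convolution

variable {V : Type*} [NormedAddCommGroup V] {σ : ℝ}

/-- Under the Fourier transform the weight of a product is bounded by the weight of either factor,
which is why one factor on the right carries no damping. -/
lemma ofReal_besselWeight_add_mul_le (hσ : 0 ≤ σ) (g h : V → ℂ) (ξ η : V) :
    ENNReal.ofReal (besselWeight σ (ξ + η)) *
        (‖besselMul (-σ) g ξ‖ₑ * ‖besselMul (-σ) h η‖ₑ)
      ≤ ENNReal.ofReal (4 ^ (σ / 2)) *
        (‖g ξ‖ₑ * ‖besselMul (-σ) h η‖ₑ + ‖besselMul (-σ) g ξ‖ₑ * ‖h η‖ₑ) := by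
  have undamp (f : V → ℂ) (ξ : V) :
      ENNReal.ofReal (besselWeight σ ξ) * ‖besselMul (-σ) f ξ‖ₑ = ‖f ξ‖ₑ := by
    rw [← enorm_besselMul, besselMul_besselMul_neg]
  calc _ ≤ ENNReal.ofReal (4 ^ (σ / 2) * (besselWeight σ ξ + besselWeight σ η)) *
        (‖besselMul (-σ) g ξ‖ₑ * ‖besselMul (-σ) h η‖ₑ) := by
        gcongr
        exact besselWeight_add_le hσ ξ η
    _ = _ := by
        rw [ENNReal.ofReal_mul (by positivity),
          ENNReal.ofReal_add (besselWeight_pos σ ξ).le (besselWeight_pos σ η).le,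
          ← undamp g ξ, ← undamp h η]
        ring

variable [InnerProductSpace ℝ V]

lemma nonneg_of_finrank_lt (hσ : (Module.finrank ℝ V : ℝ) < 2 * σ) : 0 ≤ σ := by
  have : (0 : ℝ) ≤ Module.finrank ℝ V := Nat.cast_nonneg _
  linarith

variable [FiniteDimensional ℝ V] [MeasurableSpace V] [BorelSpace V]

/-- The density of the product of the functions with densities `g` and `h`. -/
def productDensity (σ : ℝ) (g h : V → ℂ) : V → ℂ :=
  besselMul σ (besselMul (-σ) g ⋆[ContinuousLinearMap.mul ℂ ℂ, volume] besselMul (-σ) h)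

lemma enorm_productDensity_le (hσ : 0 ≤ σ) {g h : V → ℂ} (hg : AEStronglyMeasurable g volume)
    (hh : AEStronglyMeasurable (besselMul (-σ) h) volume) (ξ : V) :
    ‖productDensity σ g h ξ‖ₑ ≤ ENNReal.ofReal (4 ^ (σ / 2)) *
      (((fun η => ‖g η‖ₑ) ⋆ₗ fun η => ‖besselMul (-σ) h η‖ₑ) ξ
        + ((fun η => ‖besselMul (-σ) g η‖ₑ) ⋆ₗ fun η => ‖h η‖ₑ) ξ) := by
  have hm : AEMeasurable fun η => ‖g η‖ₑ * ‖besselMul (-σ) h (-η + ξ)‖ₑ := by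
    refine hg.enorm.mul ?_
    simp only [neg_add_eq_sub]
    exact hh.enorm.comp_quasiMeasurePreserving (quasiMeasurePreserving_sub_left volume ξ)
  calc ‖productDensity σ g h ξ‖ₑ
      ≤ ENNReal.ofReal (besselWeight σ ξ) *
          ∫⁻ η, ‖besselMul (-σ) g η‖ₑ * ‖besselMul (-σ) h (-η + ξ)‖ₑ := by
        rw [productDensity, enorm_besselMul]
        gcongr
        refine (enorm_integral_le_lintegral_enorm _).trans_eq (lintegral_congr fun η => ?_)
        rw [ContinuousLinearMap.mul_apply', enorm_mul, neg_add_eq_sub]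
    _ = ∫⁻ η, ENNReal.ofReal (besselWeight σ (η + (-η + ξ))) *
          (‖besselMul (-σ) g η‖ₑ * ‖besselMul (-σ) h (-η + ξ)‖ₑ) := by
        simp only [add_neg_cancel_left]
        rw [lintegral_const_mul' _ _ ENNReal.ofReal_ne_top]
    _ ≤ ∫⁻ η, ENNReal.ofReal (4 ^ (σ / 2)) * (‖g η‖ₑ * ‖besselMul (-σ) h (-η + ξ)‖ₑ +
          ‖besselMul (-σ) g η‖ₑ * ‖h (-η + ξ)‖ₑ) :=
        lintegral_mono fun η => ofReal_besselWeight_add_mul_le hσ g h η (-η + ξ)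
    _ = _ := by
        rw [lintegral_const_mul' _ _ ENNReal.ofReal_ne_top, lintegral_add_left' hm]
        rfl

variable (V) in
/-- A bound for the norm of the multiplication of `H^σ`. -/
def productConst (σ : ℝ) : ℝ≥0∞ :=
  ENNReal.ofReal (4 ^ (σ / 2)) *
    (2 * eLpNorm (fun ξ : V => (besselWeight (-σ) ξ : ℂ)) 2 volume)

lemma eLpNorm_productDensity_le (hσ : (Module.finrank ℝ V : ℝ) < 2 * σ) {g h : V → ℂ}
    (hg : MemLp g 2 volume) (hh : MemLp h 2 volume) :
    eLpNorm (productDensity σ g h) 2 volume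
      ≤ productConst V σ * (eLpNorm g 2 volume * eLpNorm h 2 volume) := by
  set w := eLpNorm (fun ξ : V => (besselWeight (-σ) ξ : ℂ)) 2 volume
  set A := (fun η => ‖g η‖ₑ) ⋆ₗ fun η => ‖besselMul (-σ) h η‖ₑ
  set B := (fun η => ‖besselMul (-σ) g η‖ₑ) ⋆ₗ fun η => ‖h η‖ₑ
  have mg := hg.1.enorm
  have mh := hh.1.enorm
  have mG := (integrable_besselMul_neg hσ hg).1.enorm
  have mH := (integrable_besselMul_neg hσ hh).1
  have hA : eLpNorm A 2 volume ≤ w * eLpNorm h 2 volume * eLpNorm g 2 volume := by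
    have young := eLpNorm_lconvolution_le (μ := volume) (p := 2) (by norm_num) (by norm_num)
      mH.enorm mg
    rw [lconvolution_comm, eLpNorm_enorm] at young
    exact young.trans (by gcongr; exact lintegral_enorm_besselMul_neg_le σ hh.1)
  have hB : eLpNorm B 2 volume ≤ w * eLpNorm g 2 volume * eLpNorm h 2 volume := by
    have young := eLpNorm_lconvolution_le (μ := volume) (p := 2) (by norm_num) (by norm_num) mG mh
    rw [eLpNorm_enorm] at young
    exact young.trans (by gcongr; exact lintegral_enorm_besselMul_neg_le σ hg.1)
  calc eLpNorm (productDensity σ g h) 2 volume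
      ≤ ENNReal.ofReal (4 ^ (σ / 2)) * eLpNorm (A + B) 2 volume :=
        eLpNorm_le_nnreal_smul_eLpNorm_of_ae_le_mul' (c := Real.toNNReal (4 ^ (σ / 2)))
          (Filter.Eventually.of_forall
            (enorm_productDensity_le (nonneg_of_finrank_lt hσ) hg.1 mH)) 2
    _ ≤ ENNReal.ofReal (4 ^ (σ / 2)) * (eLpNorm A 2 volume + eLpNorm B 2 volume) := by
        gcongr
        exact eLpNorm_add_le (aemeasurable_lconvolution mg mH.enorm).aestronglyMeasurable
          (aemeasurable_lconvolution mG mh).aestronglyMeasurable (by norm_num)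
    _ ≤ ENNReal.ofReal (4 ^ (σ / 2)) * (w * eLpNorm h 2 volume * eLpNorm g 2 volume +
          w * eLpNorm g 2 volume * eLpNorm h 2 volume) := by gcongr
    _ = productConst V σ * (eLpNorm g 2 volume * eLpNorm h 2 volume) := by
        rw [productConst]
        ring

lemma productConst_ne_top (hσ : (Module.finrank ℝ V : ℝ) < 2 * σ) : productConst V σ ≠ ⊤ :=
  ENNReal.mul_ne_top ENNReal.ofReal_ne_top
    (ENNReal.mul_ne_top (by norm_num) (memLp_two_besselWeight_neg hσ).2.ne)

lemma memLp_productDensity (hσ : (Module.finrank ℝ V : ℝ) < 2 * σ) (g h : Density V) :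
    MemLp (productDensity σ g h) 2 volume := by
  have hw : Continuous fun ξ : V => (besselWeight σ ξ : ℂ) := by fun_prop
  refine ⟨hw.aestronglyMeasurable.mul ((integrable_besselMul_neg hσ
    (Lp.memLp g)).integrable_convolution (ContinuousLinearMap.mul ℂ ℂ)
      (integrable_besselMul_neg hσ (Lp.memLp h))).1, ?_⟩
  exact (eLpNorm_productDensity_le hσ (Lp.memLp g) (Lp.memLp h)).trans_lt
    (ENNReal.mul_ne_top (productConst_ne_top hσ)
      (ENNReal.mul_ne_top (Lp.eLpNorm_ne_top g) (Lp.eLpNorm_ne_top h))).lt_top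

lemma synth_toLp_productDensity (hσ : (Module.finrank ℝ V : ℝ) < 2 * σ) (g h : Density V) :
    synth hσ ((memLp_productDensity hσ g h).toLp _) = synth hσ g * synth hσ h := by
  ext y
  rw [coe_synth_of_ae_eq hσ (MemLp.coeFn_toLp _), productDensity, besselMul_neg_besselMul,
    BoundedContinuousFunction.mul_apply, coe_synth, coe_synth]
  simp only [Real.fourierInv_eq_fourier_neg]
  exact Real.fourier_mul_convolution_eq (integrable_besselMul_neg hσ (Lp.memLp g))
    (integrable_besselMul_neg hσ (Lp.memLp h)) (-y)

lemma norm_toLp_productDensity_le (hσ : (Module.finrank ℝ V : ℝ) < 2 * σ) (g h : Density V) :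
    ‖(memLp_productDensity hσ g h).toLp _‖ ≤ (productConst V σ).toReal * ‖g‖ * ‖h‖ := by
  rw [Lp.norm_toLp, Lp.norm_def, Lp.norm_def, mul_assoc, ← ENNReal.toReal_mul,
    ← ENNReal.toReal_mul]
  exact ENNReal.toReal_mono (ENNReal.mul_ne_top (productConst_ne_top hσ)
    (ENNReal.mul_ne_top (Lp.eLpNorm_ne_top g) (Lp.eLpNorm_ne_top h)))
    (eLpNorm_productDensity_le hσ (Lp.memLp g) (Lp.memLp h))

/-- The multiplication of `H^σ`, on densities. -/
def synthMul (hσ : (Module.finrank ℝ V : ℝ) < 2 * σ) :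
    Density V →L[ℂ] Density V →L[ℂ] Density V :=
  LinearMap.mkContinuous₂
    (LinearMap.mk₂ ℂ (fun g h => (memLp_productDensity hσ g h).toLp _)
      (fun g g' h => synth_injective hσ <| by
        simp only [map_add, synth_toLp_productDensity, add_mul])
      (fun c g h => synth_injective hσ <| by
        simp only [map_smul, synth_toLp_productDensity, smul_mul_assoc])
      (fun g h h' => synth_injective hσ <| by
        simp only [map_add, synth_toLp_productDensity, mul_add])
      (fun c g h => synth_injective hσ <| by
        simp only [map_smul, synth_toLp_productDensity, mul_smul_comm]))
    (productConst V σ).toReal (norm_toLp_productDensity_le hσ)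

lemma synth_synthMul (hσ : (Module.finrank ℝ V : ℝ) < 2 * σ) (g h : Density V) :
    synth hσ (synthMul hσ g h) = synth hσ g * synth hσ h :=
  synth_toLp_productDensity hσ g h

end Product

/-! ### Fourier multipliers -/

section Multiplier

variable {V : Type*} [NormedAddCommGroup V] [InnerProductSpace ℝ V]

lemma norm_deriv_symbol_le (ξ w : V) :
    ‖2 * Real.pi * Complex.I * (inner ℝ ξ w : ℝ) * (besselWeight (-1) ξ : ℂ)‖
      ≤ 2 * Real.pi * ‖w‖ := by
  have norm_mul_weight_le : ‖ξ‖ * besselWeight (-1) ξ ≤ 1 := by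
    have := mul_le_mul_of_nonneg_right (norm_pow_le_besselWeight 1 ξ) (besselWeight_pos (-1) ξ).le
    rwa [besselWeight_mul, pow_one, Nat.cast_one, add_neg_cancel, besselWeight_zero] at this
  simp only [norm_mul, Complex.norm_real, Complex.norm_I, mul_one, Complex.norm_ofNat,
    Real.norm_of_nonneg Real.pi_pos.le, Real.norm_of_nonneg (besselWeight_pos (-1) ξ).le]
  calc 2 * Real.pi * ‖inner ℝ ξ w‖ * besselWeight (-1) ξ
      ≤ 2 * Real.pi * (‖ξ‖ * ‖w‖) * besselWeight (-1) ξ := by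
        gcongr
        · exact (besselWeight_pos (-1) ξ).le
        · exact norm_inner_le_norm ξ w
    _ = 2 * Real.pi * ‖w‖ * (‖ξ‖ * besselWeight (-1) ξ) := by ring
    _ ≤ 2 * Real.pi * ‖w‖ := mul_le_of_le_one_right (by positivity) norm_mul_weight_le

variable [FiniteDimensional ℝ V] [MeasurableSpace V] [BorelSpace V] {σ τ : ℝ}

/-- Multiplication by a bounded continuous function, an operator on densities. -/
def densityMultiplier (m : BoundedContinuousFunction V ℂ) : Density V →L[ℂ] Density V :=
  (ContinuousLinearMap.mul ℂ ℂ).holderL volume ⊤ 2 2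
    ((memLp_top_of_bound m.continuous.aestronglyMeasurable ‖m‖
      (Filter.Eventually.of_forall m.norm_coe_le_norm)).toLp m)

lemma coeFn_densityMultiplier (m : BoundedContinuousFunction V ℂ) (g : Density V) :
    densityMultiplier m g =ᵐ[volume] fun ξ => m ξ * g ξ := by
  have hm : MemLp m ⊤ (volume : Measure V) :=
    memLp_top_of_bound m.continuous.aestronglyMeasurable ‖m‖
      (Filter.Eventually.of_forall m.norm_coe_le_norm)
  filter_upwards [ContinuousLinearMap.coeFn_holder (r := 2) (ContinuousLinearMap.mul ℂ ℂ)
    (hm.toLp m) g, hm.coeFn_toLp] with ξ h_holder h_toLp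
  exact h_holder.trans (by rw [h_toLp]; rfl)

lemma exists_synth_inclusion (hτ : (Module.finrank ℝ V : ℝ) < 2 * τ)
    (hσ : (Module.finrank ℝ V : ℝ) < 2 * σ) (h : τ ≤ σ) :
    ∃ I : Density V →L[ℂ] Density V, ∀ g, synth hτ (I g) = synth hσ g := by
  let m : BoundedContinuousFunction V ℂ :=
    .ofNormedAddCommGroup (fun ξ => (besselWeight (τ - σ) ξ : ℂ)) (by fun_prop) 1 fun ξ => by
      rw [norm_ofReal_besselWeight, ← besselWeight_zero ξ]
      exact besselWeight_mono (by linarith) ξ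
  refine ⟨densityMultiplier m, fun g => DFunLike.coe_injective ?_⟩
  have damped_eq : besselMul (-τ) (besselMul (τ - σ) g) = besselMul (-σ) g := by
    rw [besselMul_besselMul]
    ring_nf
  rw [coe_synth_of_ae_eq hτ (f := besselMul (τ - σ) g) (coeFn_densityMultiplier m g), damped_eq,
    coe_synth]

lemma integrable_norm_pow_mul_besselMul_neg (n : ℕ)
    (hσ : (Module.finrank ℝ V : ℝ) < 2 * (σ - n)) (g : Density V) :
    Integrable fun ξ => ‖ξ‖ ^ n * ‖besselMul (-σ) g ξ‖ := by
  have hw : Continuous fun ξ : V => (besselWeight (-σ) ξ : ℂ) := by fun_prop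
  refine (integrable_besselMul_neg hσ (Lp.memLp g)).norm.mono'
    ((continuous_norm.pow n).aestronglyMeasurable.mul
      (hw.aestronglyMeasurable.mul (Lp.memLp g).1).norm) (Filter.Eventually.of_forall fun ξ => ?_)
  rw [Real.norm_of_nonneg (by positivity), besselMul, besselMul, norm_mul, norm_mul,
    norm_ofReal_besselWeight, norm_ofReal_besselWeight, ← mul_assoc]
  gcongr
  calc ‖ξ‖ ^ n * besselWeight (-σ) ξ
      ≤ besselWeight n ξ * besselWeight (-σ) ξ :=
        mul_le_mul_of_nonneg_right (norm_pow_le_besselWeight n ξ) (besselWeight_pos _ ξ).le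
    _ = besselWeight (-(σ - n)) ξ := by
        rw [besselWeight_mul]
        ring_nf

lemma contDiff_synth (n : ℕ) (hσ : (Module.finrank ℝ V : ℝ) < 2 * σ)
    (hσn : (Module.finrank ℝ V : ℝ) < 2 * (σ - n)) (g : Density V) :
    ContDiff ℝ n (synth hσ g) := by
  have contDiff_fourier : ContDiff ℝ ((n : ℕ∞) : ℕ∞ω) (𝓕 (besselMul (-σ) g)) := by
    refine Real.contDiff_fourier fun m hm => integrable_norm_pow_mul_besselMul_neg m ?_ g
    have : (m : ℝ) ≤ n := by exact_mod_cast hm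
    linarith
  rw [coe_synth, funext (Real.fourierInv_eq_fourier_neg _)]
  exact contDiff_fourier.comp contDiff_neg

lemma fderiv_fourierInv_apply {f : V → ℂ} (hf : Integrable f)
    (hf' : Integrable fun ξ => ‖ξ‖ * ‖f ξ‖) (y w : V) :
    fderiv ℝ (𝓕⁻ f) y w =
      𝓕⁻ (fun ξ => 2 * Real.pi * Complex.I * (inner ℝ ξ w : ℝ) * f ξ) y := by
  have integrable_deriv : Integrable (VectorFourier.fourierSMulRight (innerSL ℝ) f) := by
    refine (hf'.const_mul (2 * Real.pi * ‖innerSL ℝ (E := V)‖)).mono' hf.1.fourierSMulRight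
      (Filter.Eventually.of_forall fun ξ => ?_)
    exact (VectorFourier.norm_fourierSMulRight_le _ _ _).trans_eq (mul_assoc _ _ _)
  have hasFDerivAt_fourierInv :=
    (Real.hasFDerivAt_fourier hf hf' (-y)).comp y (hasFDerivAt_id y).neg
  rw [funext (Real.fourierInv_eq_fourier_neg f), ← Function.comp_def, hasFDerivAt_fourierInv.fderiv,
    Real.fourierInv_eq_fourier_neg, ContinuousLinearMap.comp_apply,
    Real.fourier_continuousLinearMap_apply integrable_deriv]
  refine congrArg (fun F : V → ℂ => 𝓕 F (-y)) (funext fun ξ => ?_)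
  rw [VectorFourier.fourierSMulRight_apply, neg_apply, ContinuousLinearMap.id_apply, map_neg,
    innerSL_apply_apply, Complex.real_smul, smul_eq_mul]
  push_cast
  ring

lemma exists_synth_eq_fderiv (hσ : (Module.finrank ℝ V : ℝ) < 2 * σ)
    (hσ' : (Module.finrank ℝ V : ℝ) < 2 * (σ - 1)) (w : V) :
    ∃ I : Density V →L[ℂ] Density V, ∀ g y, synth hσ' (I g) y = fderiv ℝ (synth hσ g) y w := by
  let m : BoundedContinuousFunction V ℂ := .ofNormedAddCommGroup _
    (show Continuous fun ξ : V =>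
      2 * Real.pi * Complex.I * (inner ℝ ξ w : ℝ) * (besselWeight (-1) ξ : ℂ) by fun_prop)
    (2 * Real.pi * ‖w‖) fun ξ => norm_deriv_symbol_le ξ w
  refine ⟨densityMultiplier m, fun g y => ?_⟩
  have integrable_norm_mul : Integrable fun ξ => ‖ξ‖ * ‖besselMul (-σ) g ξ‖ := by
    simpa only [pow_one] using
      integrable_norm_pow_mul_besselMul_neg 1 (by rwa [Nat.cast_one]) g
  rw [coe_synth hσ, fderiv_fourierInv_apply (integrable_besselMul_neg hσ (Lp.memLp g))
    integrable_norm_mul, coe_synth_of_ae_eq hσ' (coeFn_densityMultiplier m g)]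
  refine congrArg (fun F : V → ℂ => 𝓕⁻ F y) (funext fun ξ => ?_)
  have weight_split : besselWeight (-σ) ξ = besselWeight (-(σ - 1)) ξ * besselWeight (-1) ξ := by
    rw [besselWeight_mul]
    ring_nf
  simp only [besselMul, weight_split, m, BoundedContinuousFunction.coe_ofNormedAddCommGroup]
  push_cast
  ring

end Multiplier

/-! ### Cut-off functions -/

section Cutoff

variable {V : Type*} [NormedAddCommGroup V] [NormedSpace ℝ V]

lemma exists_smooth_cutoff [FiniteDimensional ℝ V] {K U : Set V} (hK : IsCompact K)
    (hU : IsOpen U) (hKU : K ⊆ U) :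
    ∃ θ : V → ℝ, ContDiff ℝ ∞ θ ∧ HasCompactSupport θ ∧ tsupport θ ⊆ U ∧
      (∀ y ∈ K, θ y = 1) ∧ ∀ y, θ y ∈ Icc (0 : ℝ) 1 := by
  obtain ⟨L, hL, hKL, hLU⟩ := exists_compact_between hK hU hKU
  obtain ⟨θ, h1, h0, h01⟩ :=
    exists_contMDiffMap_one_nhds_of_subset_interior (n := (⊤ : ℕ∞)) 𝓘(ℝ, V) hK.isClosed hKL
  have tsupport_subset : tsupport θ ⊆ L :=
    closure_minimal (fun y hy => by_contra fun hyL => hy (h0 y hyL)) hL.isClosed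
  exact ⟨θ, θ.contMDiff.contDiff, hL.of_isClosed_subset (isClosed_tsupport _) tsupport_subset,
    tsupport_subset.trans hLU, fun y hy => h1.self_of_nhdsSet y hy, h01⟩

lemma contDiff_mul_of_contDiffAt_tsupport {A : Type*} [NormedRing A] [NormedAlgebra ℝ A]
    {f g : V → A} (hf : ContDiff ℝ ∞ f) (hg : ∀ y ∈ tsupport f, ContDiffAt ℝ ∞ g y) :
    ContDiff ℝ ∞ fun y => f y * g y := by
  refine contDiff_iff_contDiffAt.2 fun y => ?_
  by_cases hy : y ∈ tsupport f
  · exact hf.contDiffAt.mul (hg y hy)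
  · refine (contDiffAt_const (c := (0 : A))).congr_of_eventuallyEq ?_
    filter_upwards [(isClosed_tsupport f).isOpen_compl.mem_nhds hy] with z hz
    rw [image_eq_zero_of_notMem_tsupport hz, zero_mul]

end Cutoff

/-! ### Characters of the algebra `H^σ` -/

section Character

variable {V : Type*} [NormedAddCommGroup V] [InnerProductSpace ℝ V] [FiniteDimensional ℝ V]
  [MeasurableSpace V] [BorelSpace V] {σ : ℝ}

/-- The densities of the test functions, i.e. of the smooth functions with compact support. -/
def testDensity (hσ : (Module.finrank ℝ V : ℝ) < 2 * σ) : Submodule ℂ (Density V) where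
  carrier := {g | ContDiff ℝ ∞ (synth hσ g) ∧ HasCompactSupport (synth hσ g)}
  zero_mem' := by
    rw [mem_ofPred_eq, map_zero]
    exact ⟨contDiff_zero_fun, HasCompactSupport.zero⟩
  add_mem' hg hh := by
    rw [mem_ofPred_eq, map_add]
    exact ⟨hg.1.add hh.1, hg.2.add hh.2⟩
  smul_mem' c g hg := by
    rw [mem_ofPred_eq, map_smul]
    exact ⟨contDiff_const.mul hg.1, hg.2.mul_left⟩

variable {hσ : (Module.finrank ℝ V : ℝ) < 2 * σ}

lemma exists_mem_testDensity {f : V → ℂ} (hf : ContDiff ℝ ∞ f) (hc : HasCompactSupport f) :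
    ∃ g ∈ testDensity hσ, ∀ y, synth hσ g y = f y := by
  obtain ⟨g, hg⟩ := exists_synth_eq_of_contDiff hσ hf hc
  have coe_eq : ⇑(synth hσ g) = f := funext hg
  exact ⟨g, ⟨coe_eq ▸ hf, coe_eq ▸ hc⟩, hg⟩

lemma synthMul_mem_testDensity {g h : Density V} (hg : g ∈ testDensity hσ)
    (hh : ContDiff ℝ ∞ (synth hσ h)) : synthMul hσ g h ∈ testDensity hσ := by
  change ContDiff ℝ ∞ (synth hσ (synthMul hσ g h)) ∧ HasCompactSupport (synth hσ (synthMul hσ g h))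
  rw [synth_synthMul, BoundedContinuousFunction.coe_mul]
  exact ⟨hg.1.mul hh, hg.2.mul_right⟩

lemma exists_mem_testDensity_eq_one_on {K : Set V} (hK : IsCompact K) :
    ∃ g ∈ testDensity hσ, ∀ y ∈ K, synth hσ g y = 1 := by
  obtain ⟨θ, hθ, hc, -, h1, -⟩ := exists_smooth_cutoff hK isOpen_univ (subset_univ K)
  obtain ⟨g, hg, hgθ⟩ := exists_mem_testDensity (hσ := hσ) (Complex.ofRealCLM.contDiff.comp hθ)
    (hc.comp_left (g := Complex.ofReal) Complex.ofReal_zero)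
  exact ⟨g, hg, fun y hy => by simp [hgθ, h1 y hy]⟩

variable {φ : Density V →L[ℂ] ℂ}

open scoped ComplexOrder in
lemma exists_mem_testDensity_pos_on (hφ : ∀ g h, φ (synthMul hσ g h) = φ g * φ h) {K : Set V}
    (hK : IsCompact K) (hcov : ∀ y ∈ K, ∃ g ∈ testDensity hσ, φ g = 0 ∧ synth hσ g y ≠ 0) :
    ∃ g ∈ testDensity hσ, φ g = 0 ∧ (∀ y, 0 ≤ synth hσ g y) ∧ ∀ y ∈ K, 0 < synth hσ g y := by
  refine hK.induction_on (p := fun K => ∃ g ∈ testDensity hσ, φ g = 0 ∧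
    (∀ y, 0 ≤ synth hσ g y) ∧ ∀ y ∈ K, 0 < synth hσ g y) ?_ ?_ ?_ fun y hy => ?_
  · exact ⟨0, zero_mem _, map_zero φ, fun y => by simp, fun y hy => hy.elim⟩
  · rintro s t hst ⟨g, hg, hφg, hg0, hgt⟩
    exact ⟨g, hg, hφg, hg0, fun y hy => hgt y (hst hy)⟩
  · rintro s t ⟨g, hg, hφg, hg0, hgs⟩ ⟨h, hh, hφh, hh0, hht⟩
    refine ⟨g + h, add_mem hg hh, by rw [map_add, hφg, hφh, add_zero], fun y => ?_, ?_⟩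
    · simpa using add_nonneg (hg0 y) (hh0 y)
    · rintro y (hy | hy)
      · simpa using add_pos_of_pos_of_nonneg (hgs y hy) (hh0 y)
      · simpa using add_pos_of_nonneg_of_pos (hg0 y) (hht y hy)
  · obtain ⟨g, hg, hφg, hgy⟩ := hcov y hy
    obtain ⟨gconj, hgconj, hstar⟩ := exists_mem_testDensity (hσ := hσ)
      (Complex.conjCLE.contDiff.comp hg.1) (hg.2.comp_left (g := starRingEnd ℂ) (map_zero _))
    have synth_mul : ∀ z, synth hσ (synthMul hσ gconj g) z = star (synth hσ g z) * synth hσ g z :=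
      fun z => by
        rw [synth_synthMul, BoundedContinuousFunction.mul_apply, hstar]
        rfl
    refine ⟨{z | synth hσ g z ≠ 0}, mem_nhdsWithin_of_mem_nhds
      ((isOpen_ne_fun (synth hσ g).continuous continuous_const).mem_nhds hgy),
      synthMul hσ gconj g, synthMul_mem_testDensity hgconj hg.1, by rw [hφ, hφg, mul_zero],
      fun z => ?_, fun z hz => ?_⟩
    · rw [synth_mul]
      exact star_mul_self_nonneg _
    · rw [synth_mul]
      exact (star_mul_self_nonneg _).lt_of_ne' (mul_ne_zero (star_ne_zero.2 hz) hz)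

open scoped ComplexOrder in
lemma exists_synth_eq_zero_of_mem_ker (hφ : ∀ g h, φ (synthMul hσ g h) = φ g * φ h)
    (hne : ∃ g ∈ testDensity hσ, φ g ≠ 0) :
    ∃ y, ∀ g ∈ testDensity hσ, φ g = 0 → synth hσ g y = 0 := by
  obtain ⟨θ, hθ, hφθ⟩ := hne
  by_contra! hcov
  obtain ⟨g, hg, hφg, -, hpos⟩ :=
    exists_mem_testDensity_pos_on hφ hθ.2.isCompact fun y _ => hcov y
  have hg0 : ∀ y ∈ tsupport (synth hσ θ), synth hσ g y ≠ 0 := fun y hy => (hpos y hy).ne'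
  obtain ⟨q, -, hq⟩ := exists_mem_testDensity (hσ := hσ)
    (contDiff_mul_of_contDiffAt_tsupport hθ.1 fun y hy => hg.1.contDiffAt.inv (hg0 y hy))
    hθ.2.mul_right
  have eq_mul : θ = synthMul hσ q g := by
    refine synth_injective hσ (BoundedContinuousFunction.ext fun y => ?_)
    rw [synth_synthMul, BoundedContinuousFunction.mul_apply, hq]
    by_cases hy : y ∈ tsupport (synth hσ θ)
    · exact (inv_mul_cancel_right₀ (hg0 y hy) _).symm
    · rw [image_eq_zero_of_notMem_tsupport hy, zero_mul, zero_mul]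
  exact hφθ (by rw [eq_mul, hφ, hφg, mul_zero])

lemma exists_eq_synth_on_testDensity (hφ : ∀ g h, φ (synthMul hσ g h) = φ g * φ h)
    {θ : Density V} (hθ : θ ∈ testDensity hσ) (hφθ : φ θ = 1) :
    ∃ y, ∀ g ∈ testDensity hσ, φ g = synth hσ g y := by
  obtain ⟨y, hy⟩ := exists_synth_eq_zero_of_mem_ker hφ ⟨θ, hθ, by simp [hφθ]⟩
  have synth_eq : ∀ g ∈ testDensity hσ, synth hσ g y = φ g * synth hσ θ y := fun g hg => by
    have := hy (g - φ g • θ) (sub_mem hg (Submodule.smul_mem _ _ hθ)) (by simp [hφθ])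
    simpa [sub_eq_zero] using this
  obtain ⟨b, hb, hby⟩ := exists_mem_testDensity_eq_one_on (hσ := hσ) (isCompact_singleton (x := y))
  have ne_zero : synth hσ θ y ≠ 0 := by
    refine right_ne_zero_of_mul (a := φ b) ?_
    rw [← synth_eq b hb, hby y rfl]
    exact one_ne_zero
  have sq_eq := synth_eq _ (synthMul_mem_testDensity hθ hθ.1)
  rw [synth_synthMul, BoundedContinuousFunction.mul_apply, hφ, hφθ, one_mul, one_mul] at sq_eq
  have eq_one : synth hσ θ y = 1 := (mul_eq_left₀ ne_zero).1 sq_eq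
  exact ⟨y, fun g hg => by rw [synth_eq g hg, eq_one, mul_one]⟩

theorem exists_eq_synth (hφ : ∀ g h, φ (synthMul hσ g h) = φ g * φ h)
    (hne : ∃ g ∈ testDensity hσ, φ g ≠ 0) : ∃ y, ∀ g, φ g = synth hσ g y := by
  obtain ⟨θ, hθ, hφθ⟩ : ∃ θ ∈ testDensity hσ, φ θ = 1 := by
    obtain ⟨g, hg, hφg⟩ := hne
    exact ⟨(φ g)⁻¹ • g, Submodule.smul_mem _ _ hg, by simp [hφg]⟩
  obtain ⟨y, hy⟩ := exists_eq_synth_on_testDensity hφ hθ hφθ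
  refine ⟨y, fun g => ?_⟩
  refine (dense_synth_schwartz hσ).induction (P := fun g => φ g = synth hσ g y) ?_
    (isClosed_eq (by fun_prop)
      ((BoundedContinuousFunction.evalCLM ℂ y).comp (synth hσ)).continuous) g
  rintro g ⟨f, hf⟩
  have smooth : ContDiff ℝ ∞ (synth hσ g) := (funext hf : ⇑(synth hσ g) = f) ▸ f.smooth ⊤
  have := hy _ (synthMul_mem_testDensity hθ smooth)
  rwa [hφ, hφθ, one_mul, synth_synthMul, BoundedContinuousFunction.mul_apply, ← hy θ hθ, hφθ,
    one_mul] at this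

end Character

/-! ### Quasi-inverses -/

section QuasiInverse

lemma add_snd_add_mul_snd_eq_zero {R A : Type*} [Semiring R] [NonUnitalNonAssocSemiring A]
    [Module R A] {a : A} {x : Unitization R A} (h : (1 + (a : Unitization R A)) * x = 1) :
    a + x.snd + a * x.snd = 0 := by
  obtain ⟨fst_eq, snd_eq⟩ := Unitization.ext_iff.mp h
  simp only [Unitization.fst_mul, Unitization.fst_add, Unitization.fst_one,
    Unitization.fst_inr, add_zero, one_mul] at fst_eq
  simp only [Unitization.snd_mul, Unitization.fst_add, Unitization.fst_one, Unitization.fst_inr,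
    Unitization.snd_add, Unitization.snd_one, Unitization.snd_inr, add_zero, zero_add, one_smul,
    fst_eq] at snd_eq
  rwa [add_comm a]

lemma exists_continuousOn_quasiInverse {A X : Type*} [NonUnitalNormedCommRing A]
    [NormedSpace ℂ A] [IsScalarTower ℂ A A] [SMulCommClass ℂ A A] [CompleteSpace A]
    [TopologicalSpace X] {D : Set X} {G : X → A} (hG : ContinuousOn G D)
    (hφ : ∀ φ : A →L[ℂ] ℂ, (∀ a b, φ (a * b) = φ a * φ b) → ∀ S ∈ D, φ (G S) ≠ -1) :
    ∃ H : X → A, ContinuousOn H D ∧ ∀ S ∈ D, G S + H S + G S * H S = 0 := by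
  let : NormedCommRing (WithLp 1 (Unitization ℂ A)) :=
    { WithLp.instUnitizationNormedRing with
      mul_comm := fun a b => congrArg (WithLp.toLp 1) (mul_comm (WithLp.ofLp a) (WithLp.ofLp b)) }
  let incl : A →L[ℂ] WithLp 1 (Unitization ℂ A) :=
    ⟨(WithLp.linearEquiv 1 ℂ _).symm.toLinearMap ∘ₗ Unitization.inrHom ℂ ℂ A,
      WithLp.unitization_isometry_inr.continuous⟩
  have incl_mul : ∀ a b, incl (a * b) = incl a * incl b := fun a b =>
    congrArg (WithLp.toLp 1) (Unitization.inr_mul ℂ a b)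
  have isUnit : ∀ S ∈ D, IsUnit (1 + incl (G S)) := fun S hS => by
    by_contra hu
    obtain ⟨f, hf⟩ := WeakDual.CharacterSpace.exists_apply_eq_zero hu
    refine hφ ((WeakDual.CharacterSpace.toCLM f).comp incl)
      (fun a b => (congrArg f (incl_mul a b)).trans (map_mul f _ _)) S hS ?_
    rw [map_add, map_one] at hf
    exact eq_neg_of_add_eq_zero_right hf
  have continuous_snd : Continuous fun a : WithLp 1 (Unitization ℂ A) => (WithLp.ofLp a).snd :=
    (WithLp.sndL 1 ℂ ℂ A).continuous.comp
      (WithLp.uniformEquiv_unitization_addEquiv_prod ℂ A).continuous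
  refine ⟨fun S => (WithLp.ofLp (Ring.inverse (1 + incl (G S)))).snd, fun S hS => ?_,
    fun S hS => ?_⟩
  · obtain ⟨u, hu⟩ := isUnit S hS
    have inverse_continuousAt : ContinuousAt Ring.inverse (1 + incl (G S)) :=
      hu ▸ NormedRing.inverse_continuousAt u
    have continuousWithinAt : ContinuousWithinAt (fun S => 1 + incl (G S)) D S :=
      (incl.continuous.continuousAt.comp_continuousWithinAt (hG S hS)).const_add 1
    exact continuous_snd.continuousAt.comp_continuousWithinAt
      (ContinuousAt.comp_continuousWithinAt (f := fun S => 1 + incl (G S)) inverse_continuousAt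
        continuousWithinAt)
  · have mul_inverse := congrArg WithLp.ofLp (Ring.mul_inverse_cancel _ (isUnit S hS))
    rw [WithLp.unitization_mul] at mul_inverse
    exact add_snd_add_mul_snd_eq_zero mul_inverse

end QuasiInverse

section Inversion

variable {V : Type*} [NormedAddCommGroup V] [InnerProductSpace ℝ V] [FiniteDimensional ℝ V]
  [MeasurableSpace V] [BorelSpace V] {σ : ℝ} {hσ : (Module.finrank ℝ V : ℝ) < 2 * σ}

/-- The densities of `H^σ` with the multiplication of `H^σ` divided by a constant, so that the
norm becomes submultiplicative. -/
def HsAlgebra (_hσ : (Module.finrank ℝ V : ℝ) < 2 * σ) : Type _ := Density V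

namespace HsAlgebra

instance : NormedAddCommGroup (HsAlgebra hσ) := inferInstanceAs (NormedAddCommGroup (Density V))

instance : NormedSpace ℂ (HsAlgebra hσ) := inferInstanceAs (NormedSpace ℂ (Density V))

instance : CompleteSpace (HsAlgebra hσ) := inferInstanceAs (CompleteSpace (Density V))

variable (hσ) in
/-- The constant by which the multiplication of `H^σ` is divided in `HsAlgebra`. -/
def mulConst : ℝ := ‖synthMul hσ‖ + 1

lemma mulConst_pos : 0 < mulConst hσ := by
  unfold mulConst
  positivity

lemma mulConst_ne_zero : (mulConst hσ : ℂ) ≠ 0 := Complex.ofReal_ne_zero.2 mulConst_pos.ne'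

variable (hσ) in
/-- The multiplication of `HsAlgebra`. -/
def mulCLM : Density V →L[ℂ] Density V →L[ℂ] Density V := (mulConst hσ : ℂ)⁻¹ • synthMul hσ

lemma norm_mulCLM_le (g h : Density V) : ‖mulCLM hσ g h‖ ≤ ‖g‖ * ‖h‖ := by
  change ‖(mulConst hσ : ℂ)⁻¹ • synthMul hσ g h‖ ≤ ‖g‖ * ‖h‖
  rw [norm_smul, norm_inv, Complex.norm_of_nonneg mulConst_pos.le, inv_mul_le_iff₀ mulConst_pos,
    ← mul_assoc]
  refine ((synthMul hσ).le_opNorm₂ g h).trans ?_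
  gcongr
  exact le_add_of_nonneg_right zero_le_one

lemma synth_mulCLM (g h : Density V) :
    synth hσ (mulCLM hσ g h) = (mulConst hσ : ℂ)⁻¹ • (synth hσ g * synth hσ h) := by
  rw [← synth_synthMul, ← map_smul]
  rfl

lemma mulCLM_comm (g h : Density V) : mulCLM hσ g h = mulCLM hσ h g :=
  synth_injective hσ (by rw [synth_mulCLM, synth_mulCLM, mul_comm])

lemma mulCLM_assoc (g h k : Density V) :
    mulCLM hσ (mulCLM hσ g h) k = mulCLM hσ g (mulCLM hσ h k) :=
  synth_injective hσ (by
    rw [synth_mulCLM, synth_mulCLM, synth_mulCLM, synth_mulCLM, smul_mul_assoc, mul_smul_comm,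
      mul_assoc])

instance : NonUnitalNormedCommRing (HsAlgebra hσ) where
  __ := (inferInstance : NormedAddCommGroup (HsAlgebra hσ))
  mul := fun g h => mulCLM hσ g h
  left_distrib g h k := map_add (mulCLM hσ g) h k
  right_distrib g h k := congrArg (· k) (map_add (mulCLM hσ) g h)
  zero_mul g := congrArg (· g) (map_zero (mulCLM hσ))
  mul_zero g := map_zero (mulCLM hσ g)
  mul_assoc := mulCLM_assoc
  mul_comm := mulCLM_comm
  norm_mul_le := norm_mulCLM_le

instance : IsScalarTower ℂ (HsAlgebra hσ) (HsAlgebra hσ) where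
  smul_assoc c g h := congrArg (· h) (map_smul (mulCLM hσ) c g)

instance : SMulCommClass ℂ (HsAlgebra hσ) (HsAlgebra hσ) where
  smul_comm c g h := (map_smul (mulCLM hσ g) c h).symm

end HsAlgebra

lemma synthMul_eq_smul (g h : Density V) :
    synthMul hσ g h = (HsAlgebra.mulConst hσ : ℂ) • HsAlgebra.mulCLM hσ g h :=
  (smul_inv_smul₀ HsAlgebra.mulConst_ne_zero _).symm

lemma ne_neg_one_of_one_add_synth_ne_zero {φ : Density V →L[ℂ] ℂ}
    (hφ : ∀ g h, φ (synthMul hσ g h) = φ g * φ h) {g : Density V}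
    (hc : HasCompactSupport (synth hσ g)) (hne : ∀ y, 1 + synth hσ g y ≠ 0) : φ g ≠ -1 := by
  intro hφg
  obtain ⟨θ, hθ, hθ1⟩ := exists_mem_testDensity_eq_one_on (hσ := hσ) hc.isCompact
  have mul_eq : synthMul hσ θ g = g := by
    refine synth_injective hσ (BoundedContinuousFunction.ext fun y => ?_)
    rw [synth_synthMul, BoundedContinuousFunction.mul_apply]
    by_cases hy : y ∈ tsupport (synth hσ g)
    · rw [hθ1 y hy, one_mul]
    · rw [image_eq_zero_of_notMem_tsupport hy, mul_zero]
  have hφθ : φ θ = 1 := by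
    have := hφ θ g
    rw [mul_eq, hφg] at this
    linear_combination this
  obtain ⟨y, hy⟩ := exists_eq_synth hφ ⟨θ, hθ, by simp [hφθ]⟩
  exact hne y (by rw [← hy, hφg, add_neg_cancel])

theorem exists_continuousOn_inverse {X : Type*} [TopologicalSpace X] {D : Set X}
    {G : X → Density V} (hG : ContinuousOn G D)
    (hc : ∀ S ∈ D, HasCompactSupport (synth hσ (G S)))
    (hne : ∀ S ∈ D, ∀ y, 1 + synth hσ (G S) y ≠ 0) :
    ∃ H : X → Density V, ContinuousOn H D ∧
      ∀ S ∈ D, ∀ y, (1 + synth hσ (G S) y) * (1 + synth hσ (H S) y) = 1 := by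
  let K : ℂ := HsAlgebra.mulConst hσ
  have hK : K ≠ 0 := HsAlgebra.mulConst_ne_zero
  obtain ⟨(H : X → Density V), hH, hGH⟩ := exists_continuousOn_quasiInverse (A := HsAlgebra hσ)
    (G := fun S => K • G S) (hG.const_smul K) fun φ hφ S hS hφG => by
      let ψ : Density V →L[ℂ] ℂ := K • (φ : Density V →L[ℂ] ℂ)
      have ψ_mul : ∀ g h, ψ (synthMul hσ g h) = ψ g * ψ h := fun g h => by
        change K * φ (synthMul hσ g h) = K * φ g * (K * φ h)
        rw [synthMul_eq_smul]
        exact ((congrArg (K * ·) (map_smul φ K _)).trans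
          (congrArg (fun z => K * (K * z)) (hφ g h))).trans (by ring)
      exact ne_neg_one_of_one_add_synth_ne_zero ψ_mul (hc S hS) (hne S hS)
        ((map_smul φ K (G S)).symm.trans hφG)
  refine ⟨fun S => K⁻¹ • H S, hH.const_smul K⁻¹, fun S hS y => ?_⟩
  have quasiInverse : K • G S + H S + HsAlgebra.mulCLM hσ (K • G S) (H S) = 0 := hGH S hS
  replace quasiInverse := congrArg (synth hσ) quasiInverse
  rw [map_add, map_add, HsAlgebra.synth_mulCLM, map_smul, map_zero] at quasiInverse
  replace quasiInverse : K * synth hσ (G S) y + synth hσ (H S) y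
    + K⁻¹ * (K * synth hσ (G S) y * synth hσ (H S) y) = 0 := DFunLike.congr_fun quasiInverse y
  rw [map_smul, BoundedContinuousFunction.smul_apply, smul_eq_mul]
  field_simp at quasiInverse ⊢
  linear_combination quasiInverse

end Inversion

/-! ### Families of functions which are locally of class `H^σ` -/

section Local

variable {V : Type*} [NormedAddCommGroup V]

lemma hasCompactSupport_ofReal_mul {χ : V → ℝ} (hc : HasCompactSupport χ) (f : V → ℝ) :
    HasCompactSupport fun y => ((χ y * f y : ℝ) : ℂ) :=
  (hc.mul_right (f' := f)).comp_left (g := Complex.ofReal) Complex.ofReal_zero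

variable [NormedSpace ℝ V]

lemma fderiv_ofReal_mul_of_differentiableAt_tsupport {χ f : V → ℝ} (hχ : Differentiable ℝ χ)
    (hf : ∀ y ∈ tsupport χ, DifferentiableAt ℝ f y) (y w : V) :
    fderiv ℝ (fun y => ((χ y * f y : ℝ) : ℂ)) y w
      = ((χ y * fderiv ℝ f y w + fderiv ℝ χ y w * f y : ℝ) : ℂ) := by
  by_cases hy : y ∈ tsupport χ
  · have hasFDerivAt_mul := Complex.ofRealCLM.hasFDerivAt.comp y
      ((hχ y).hasFDerivAt.mul (hf y hy).hasFDerivAt)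
    refine (congrArg (· w) hasFDerivAt_mul.fderiv).trans (congrArg Complex.ofReal ?_)
    change χ y * fderiv ℝ f y w + f y * fderiv ℝ χ y w = _
    ring
  · have eventually_zero : (fun y => ((χ y * f y : ℝ) : ℂ)) =ᶠ[𝓝 y] fun _ => 0 := by
      filter_upwards [(isClosed_tsupport χ).isOpen_compl.mem_nhds hy] with z hz
      rw [image_eq_zero_of_notMem_tsupport hz, zero_mul, Complex.ofReal_zero]
    have fderiv_eq_zero : fderiv ℝ χ y w = 0 :=
      image_eq_zero_of_notMem_tsupport (f := fun y => fderiv ℝ χ y w) fun h =>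
        hy (tsupport_fderiv_apply_subset ℝ w h)
    rw [eventually_zero.fderiv_eq, fderiv_eq_zero, image_eq_zero_of_notMem_tsupport hy]
    simp

end Local

/-- The family `f S` of functions on the open set `Ω`, with the parameter `S ∈ D`, is locally of
class `H^σ` and depends continuously on `S` in the local `H^σ` topology. -/
def LocHs {X V : Type*} [TopologicalSpace X] [NormedAddCommGroup V] [InnerProductSpace ℝ V]
    [FiniteDimensional ℝ V] [MeasurableSpace V] [BorelSpace V] (Ω : Set V) {σ : ℝ}
    (hσ : (Module.finrank ℝ V : ℝ) < 2 * σ) (D : Set X) (f : X → V → ℝ) : Prop :=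
  ∀ χ : V → ℝ, ContDiff ℝ ∞ χ → HasCompactSupport χ → tsupport χ ⊆ Ω →
    ∃ G : X → Density V, ContinuousOn G D ∧
      ∀ S ∈ D, ∀ y, synth hσ (G S) y = ((χ y * f S y : ℝ) : ℂ)

namespace LocHs

variable {X V : Type*} [TopologicalSpace X] [NormedAddCommGroup V] [InnerProductSpace ℝ V]
  [FiniteDimensional ℝ V] [MeasurableSpace V] [BorelSpace V] {Ω : Set V} {σ τ : ℝ}
  {hσ : (Module.finrank ℝ V : ℝ) < 2 * σ} {D : Set X} {f f' : X → V → ℝ}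

lemma congr (h : LocHs Ω hσ D f) (he : ∀ S ∈ D, ∀ y ∈ Ω, f S y = f' S y) :
    LocHs Ω hσ D f' := by
  intro χ hχ hc hsub
  obtain ⟨G, hG, hGf⟩ := h χ hχ hc hsub
  refine ⟨G, hG, fun S hS y => ?_⟩
  rw [hGf S hS]
  by_cases hy : y ∈ tsupport χ
  · rw [he S hS y (hsub hy)]
  · simp [image_eq_zero_of_notMem_tsupport hy]

lemma add (h : LocHs Ω hσ D f) (h' : LocHs Ω hσ D f') :
    LocHs Ω hσ D (fun S y => f S y + f' S y) := by
  intro χ hχ hc hsub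
  obtain ⟨G, hG, hGf⟩ := h χ hχ hc hsub
  obtain ⟨G', hG', hGf'⟩ := h' χ hχ hc hsub
  refine ⟨fun S => G S + G' S, hG.add hG', fun S hS y => ?_⟩
  rw [map_add, BoundedContinuousFunction.add_apply, hGf S hS, hGf' S hS]
  push_cast
  ring

lemma mul (h : LocHs Ω hσ D f) (h' : LocHs Ω hσ D f') (hΩ : IsOpen Ω) :
    LocHs Ω hσ D (fun S y => f S y * f' S y) := by
  intro χ hχ hc hsub
  obtain ⟨θ, hθ, hθc, hθΩ, hθ1, -⟩ := exists_smooth_cutoff hc.isCompact hΩ hsub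
  obtain ⟨G, hG, hGf⟩ := h χ hχ hc hsub
  obtain ⟨G', hG', hGf'⟩ := h' θ hθ hθc hθΩ
  refine ⟨fun S => synthMul hσ (G S) (G' S),
    ((synthMul hσ).continuous.comp_continuousOn hG).clm_apply hG', fun S hS y => ?_⟩
  rw [synth_synthMul, BoundedContinuousFunction.mul_apply, hGf S hS, hGf' S hS,
    ← Complex.ofReal_mul]
  by_cases hy : y ∈ tsupport χ
  · rw [hθ1 y hy, one_mul, mul_assoc]
  · simp [image_eq_zero_of_notMem_tsupport hy]

lemma of_contDiffOn (hΩ : IsOpen Ω) {F : V → ℝ} (hF : ContDiffOn ℝ ∞ F Ω) {c : X → ℝ}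
    (hc : ContinuousOn c D) : LocHs Ω hσ D (fun S y => c S * F y) := by
  intro χ hχ hχc hsub
  have contDiff_mul := contDiff_mul_of_contDiffAt_tsupport hχ fun y hy =>
    hF.contDiffAt (hΩ.mem_nhds (hsub hy))
  obtain ⟨g, hg⟩ := exists_synth_eq_of_contDiff hσ (Complex.ofRealCLM.contDiff.comp contDiff_mul)
    (hasCompactSupport_ofReal_mul hχc F)
  refine ⟨fun S => (c S : ℂ) • g,
    (Complex.continuous_ofReal.comp_continuousOn hc).smul continuousOn_const, fun S _ y => ?_⟩
  rw [map_smul, BoundedContinuousFunction.smul_apply, hg, smul_eq_mul, Function.comp_apply,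
    Complex.ofRealCLM_apply, ← Complex.ofReal_mul, mul_left_comm]

lemma smooth (hΩ : IsOpen Ω) {F : V → ℝ} (hF : ContDiffOn ℝ ∞ F Ω) :
    LocHs Ω hσ D (fun _ y => F y) :=
  (of_contDiffOn hΩ hF (c := fun _ => 1) continuousOn_const).congr fun _ _ _ _ => one_mul _

lemma scalar (hΩ : IsOpen Ω) {c : X → ℝ} (hc : ContinuousOn c D) :
    LocHs Ω hσ D (fun S _ => c S) :=
  (of_contDiffOn hΩ contDiffOn_const hc (F := fun _ => 1)).congr fun _ _ _ _ => mul_one _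

lemma const_mul (h : LocHs Ω hσ D f) (hΩ : IsOpen Ω) (c : ℝ) :
    LocHs Ω hσ D (fun S y => c * f S y) :=
  (scalar hΩ continuousOn_const).mul h hΩ

lemma sub (h : LocHs Ω hσ D f) (h' : LocHs Ω hσ D f') (hΩ : IsOpen Ω) :
    LocHs Ω hσ D (fun S y => f S y - f' S y) :=
  (h.add (h'.const_mul hΩ (-1))).congr fun _ _ _ _ => by ring

lemma pow (h : LocHs Ω hσ D f) (hΩ : IsOpen Ω) (n : ℕ) :
    LocHs Ω hσ D (fun S y => f S y ^ n) := by
  induction n with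
  | zero => exact (smooth hΩ contDiffOn_const (F := fun _ => 1)).congr fun _ _ _ _ => by simp
  | succ n ih => exact (ih.mul h hΩ).congr fun _ _ _ _ => by rw [pow_succ]

lemma sum (hΩ : IsOpen Ω) {ι : Type*} (t : Finset ι) {F : ι → X → V → ℝ}
    (h : ∀ i ∈ t, LocHs Ω hσ D (F i)) : LocHs Ω hσ D (fun S y => ∑ i ∈ t, F i S y) := by
  classical
  induction t using Finset.induction_on with
  | empty => simpa using smooth (X := X) (hσ := hσ) (D := D) hΩ (contDiffOn_const (c := (0 : ℝ)))
  | insert a s ha ih =>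
    refine ((h a (Finset.mem_insert_self _ _)).add
      (ih fun i hi => h i (Finset.mem_insert_of_mem hi))).congr fun S _ y _ => ?_
    rw [Finset.sum_insert ha]

lemma inv (h : LocHs Ω hσ D f) (hΩ : IsOpen Ω) (hpos : ∀ S ∈ D, ∀ y ∈ Ω, 0 < f S y) :
    LocHs Ω hσ D (fun S y => (f S y)⁻¹) := by
  intro χ hχ hc hsub
  -- `1 + θ (f - 1)` is positive everywhere, lies in `1 + H^σ`, and equals `f` where `χ` lives.
  obtain ⟨θ, hθ, hθc, hθΩ, hθ1, hθ01⟩ := exists_smooth_cutoff hc.isCompact hΩ hsub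
  obtain ⟨G, hG, hGf⟩ := (h.sub (smooth hΩ (contDiffOn_const (c := (1 : ℝ)))) hΩ) θ hθ hθc hθΩ
  have pos : ∀ S ∈ D, ∀ y, 0 < 1 + θ y * (f S y - 1) := fun S hS y => by
    by_cases hy : y ∈ tsupport θ
    · have f_pos := hpos S hS y (hθΩ hy)
      obtain ⟨θ_nonneg, θ_le⟩ := hθ01 y
      rcases θ_le.lt_or_eq with θ_lt | θ_eq
      · nlinarith
      · rw [θ_eq]
        linarith
    · simp [image_eq_zero_of_notMem_tsupport hy]
  obtain ⟨H, hH, hGH⟩ := exists_continuousOn_inverse hG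
    (fun S hS => by
      rw [funext (hGf S hS)]
      exact hasCompactSupport_ofReal_mul hθc _)
    (fun S hS y => by
      rw [hGf S hS]
      exact_mod_cast (pos S hS y).ne')
  obtain ⟨g, hg⟩ := exists_synth_eq_of_contDiff hσ (Complex.ofRealCLM.contDiff.comp hχ)
    (hc.comp_left (g := Complex.ofReal) Complex.ofReal_zero)
  refine ⟨fun S => g + synthMul hσ g (H S),
    continuousOn_const.add ((synthMul hσ g).continuous.comp_continuousOn hH), fun S hS y => ?_⟩
  have mul_eq_one := hGH S hS y
  rw [map_add, synth_synthMul, BoundedContinuousFunction.add_apply,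
    BoundedContinuousFunction.mul_apply, hg, ← mul_one_add, Function.comp_apply,
    Complex.ofRealCLM_apply, Complex.ofReal_mul]
  by_cases hy : y ∈ tsupport χ
  · rw [hGf S hS, hθ1 y hy, one_mul, Complex.ofReal_sub, Complex.ofReal_one,
      add_sub_cancel] at mul_eq_one
    rw [eq_inv_of_mul_eq_one_right mul_eq_one, Complex.ofReal_inv]
  · simp [image_eq_zero_of_notMem_tsupport hy]

lemma mono {hτ : (Module.finrank ℝ V : ℝ) < 2 * τ} (h : LocHs Ω hσ D f) (hle : τ ≤ σ) :
    LocHs Ω hτ D f := by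
  intro χ hχ hc hsub
  obtain ⟨G, hG, hGf⟩ := h χ hχ hc hsub
  obtain ⟨I, hI⟩ := exists_synth_inclusion hτ hσ hle
  exact ⟨fun S => I (G S), I.continuous.comp_continuousOn hG, fun S hS y => by rw [hI, hGf S hS]⟩

lemma contDiffOn (h : LocHs Ω hσ D f) (hΩ : IsOpen Ω) (n : ℕ)
    (hn : (Module.finrank ℝ V : ℝ) < 2 * (σ - n)) {S : X} (hS : S ∈ D) :
    ContDiffOn ℝ n (f S) Ω := by
  intro y hy
  obtain ⟨K, hK, hyK, hKΩ⟩ := exists_compact_subset hΩ hy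
  obtain ⟨θ, hθ, hθc, hθΩ, hθ1, -⟩ := exists_smooth_cutoff hK hΩ hKΩ
  obtain ⟨G, -, hGf⟩ := h θ hθ hθc hθΩ
  have contDiff_re : ContDiff ℝ n (fun y => (synth hσ (G S) y).re) :=
    Complex.reCLM.contDiff.comp (contDiff_synth n hσ hn (G S))
  have eventuallyEq : f S =ᶠ[𝓝 y] fun z => (synth hσ (G S) z).re := by
    filter_upwards [mem_interior_iff_mem_nhds.1 hyK] with z hz
    rw [hGf S hS, Complex.ofReal_re, hθ1 z hz, one_mul]
  exact (contDiff_re.contDiffAt.congr_of_eventuallyEq eventuallyEq).contDiffWithinAt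

lemma fderiv_apply {hσ' : (Module.finrank ℝ V : ℝ) < 2 * (σ - 1)} (h : LocHs Ω hσ D f)
    (hΩ : IsOpen Ω) (w : V) : LocHs Ω hσ' D (fun S y => fderiv ℝ (f S) y w) := by
  have differentiableAt : ∀ S ∈ D, ∀ y ∈ Ω, DifferentiableAt ℝ (f S) y := fun S hS y hy =>
    ((h.contDiffOn hΩ 1 (by simpa using hσ') hS).contDiffAt
      (hΩ.mem_nhds hy)).differentiableAt (by norm_num)
  intro χ hχ hc hsub
  have tsupport_subset : tsupport (fun y => fderiv ℝ χ y w) ⊆ tsupport χ :=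
    tsupport_fderiv_apply_subset ℝ w
  obtain ⟨G, hG, hGf⟩ := h χ hχ hc hsub
  obtain ⟨G', hG', hGf'⟩ := (h.mono (hτ := hσ') (by linarith)) (fun y => fderiv ℝ χ y w)
    ((hχ.fderiv_right (m := ∞) (by simp)).clm_apply contDiff_const)
    (hc.of_isClosed_subset (isClosed_tsupport _) tsupport_subset) (tsupport_subset.trans hsub)
  obtain ⟨I, hI⟩ := exists_synth_eq_fderiv hσ hσ' w
  refine ⟨fun S => I (G S) - G' S, (I.continuous.comp_continuousOn hG).sub hG', fun S hS y => ?_⟩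
  rw [map_sub, BoundedContinuousFunction.sub_apply, hI, funext (hGf S hS), hGf' S hS,
    fderiv_ofReal_mul_of_differentiableAt_tsupport (hχ.differentiable (by simp))
      fun z hz => differentiableAt S hS z (hsub hz)]
  push_cast
  ring

end LocHs

/-! ### Contractions with the inverse Gram matrix of a basis -/

section Gram

open LinearMap (toMatrix₂)
open Module (Basis)
open scoped Matrix

section Norm

variable {R V ι κ : Type*} [CommRing R] [Fintype κ]

/-- The `κ`-th tensor power of a matrix, with multi-indices `κ → ι` as row and column indices. -/
def matrixTensorPow (κ : Type*) [Fintype κ] (A : Matrix ι ι R) : Matrix (κ → ι) (κ → ι) R :=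
  Matrix.of fun i j => ∏ k, A (i k) (j k)

lemma matrixTensorPow_transpose (A : Matrix ι ι R) :
    matrixTensorPow κ Aᵀ = (matrixTensorPow κ A)ᵀ := rfl

variable [Fintype ι] [DecidableEq κ]

lemma matrixTensorPow_mul (A B : Matrix ι ι R) :
    matrixTensorPow κ (A * B) = matrixTensorPow κ A * matrixTensorPow κ B := by
  ext i j
  simp only [matrixTensorPow, Matrix.of_apply, Matrix.mul_apply]
  rw [Finset.prod_univ_sum, Fintype.piFinset_univ]
  simp only [Finset.prod_mul_distrib]

variable [AddCommGroup V] [Module R V] (b b' : Basis ι R V)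

lemma multilinearMap_change_basis (F : MultilinearMap R (fun _ : κ => V) R) (j : κ → ι) :
    F (b' ∘ j) = ((matrixTensorPow κ (b.toMatrix b'))ᵀ *ᵥ fun i => F (b ∘ i)) j := by
  have expand : b' ∘ j = fun k => ∑ a, b.toMatrix b' a (j k) • b a :=
    funext fun k => (b.sum_toMatrix_smul_self b' (j k)).symm
  rw [expand, F.map_sum]
  exact Finset.sum_congr rfl fun i _ => F.map_smul_univ _ _

variable [DecidableEq ι]

lemma inv_toMatrix₂_change_basis (B : V →ₗ[R] V →ₗ[R] R) :
    (toMatrix₂ b b B)⁻¹ = b.toMatrix b' * (toMatrix₂ b' b' B)⁻¹ * (b.toMatrix b')ᵀ := by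
  have inv_left : (b.toMatrix b')⁻¹ = b'.toMatrix b :=
    Matrix.inv_eq_right_inv (b.toMatrix_mul_toMatrix_flip b')
  have transpose_mul : (b'.toMatrix b)ᵀ * (b.toMatrix b')ᵀ = 1 := by
    rw [← Matrix.transpose_mul, b.toMatrix_mul_toMatrix_flip, Matrix.transpose_one]
  rw [← LinearMap.toMatrix₂_mul_basis_toMatrix b b b' b' B, Matrix.mul_inv_rev, Matrix.mul_inv_rev,
    ← Matrix.transpose_nonsing_inv, inv_left, ← mul_assoc, ← mul_assoc,
    b.toMatrix_mul_toMatrix_flip, one_mul, mul_assoc, transpose_mul, mul_one]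

/-- The contraction `b^{i₁j₁} ⋯ b^{i_pj_p} F_{i₁…i_p} F_{j₁…j_p}` of two copies of a multilinear
form, where `b^{ij}` is the inverse of the Gram matrix of the bilinear form `B` in the basis. -/
def gramContraction (B : V →ₗ[R] V →ₗ[R] R) (F : MultilinearMap R (fun _ : κ => V) R) : R :=
  ∑ i : κ → ι, ∑ j : κ → ι, (∏ k, (toMatrix₂ b b B)⁻¹ (i k) (j k)) * F (b ∘ i) * F (b ∘ j)

lemma gramContraction_eq_dotProduct (B : V →ₗ[R] V →ₗ[R] R)
    (F : MultilinearMap R (fun _ : κ => V) R) :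
    gramContraction b B F = (fun i => F (b ∘ i)) ⬝ᵥ
      matrixTensorPow κ (toMatrix₂ b b B)⁻¹ *ᵥ fun i => F (b ∘ i) := by
  simp only [gramContraction, dotProduct, Matrix.mulVec, matrixTensorPow, Matrix.of_apply,
    Finset.mul_sum]
  refine Finset.sum_congr rfl fun i _ => Finset.sum_congr rfl fun j _ => ?_
  ring

lemma gramContraction_change_basis (B : V →ₗ[R] V →ₗ[R] R)
    (F : MultilinearMap R (fun _ : κ => V) R) :
    gramContraction b B F = gramContraction b' B F := by
  rw [gramContraction_eq_dotProduct, gramContraction_eq_dotProduct,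
    funext (multilinearMap_change_basis b b' F), inv_toMatrix₂_change_basis b b',
    matrixTensorPow_mul, matrixTensorPow_mul, matrixTensorPow_transpose, ← Matrix.mulVec_mulVec,
    ← Matrix.mulVec_mulVec, Matrix.dotProduct_mulVec _ (matrixTensorPow κ (b.toMatrix b')),
    ← Matrix.mulVec_transpose]

end Norm

section Gradient

variable {K V ι : Type*} [Field K] [Fintype ι] [DecidableEq ι] [AddCommGroup V] [Module K V]

/-- The vector `b^{ij} d(b_j) b_i` which represents the linear form `d`, where `b^{ij}` is the
inverse of the Gram matrix of the bilinear form `B` in the basis. -/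
def gramDual (b : Basis ι K V) (B : V →ₗ[K] V →ₗ[K] K) (d : V →ₗ[K] K) : V :=
  ∑ i, ∑ j, ((toMatrix₂ b b B)⁻¹ i j * d (b j)) • b i

variable (b b' : Basis ι K V) {B : V →ₗ[K] V →ₗ[K] K}

lemma apply_gramDual (hsymm : B.IsSymm) (hsep : B.SeparatingLeft) (d : V →ₗ[K] K) :
    B (gramDual b B d) = d := by
  refine b.ext fun k => ?_
  have isUnit_det : IsUnit (toMatrix₂ b b B).det :=
    ((LinearMap.separatingLeft_iff_det_ne_zero b).1 hsep).isUnit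
  calc B (gramDual b B d) (b k)
      = (toMatrix₂ b b B *ᵥ (toMatrix₂ b b B)⁻¹ *ᵥ fun j => d (b j)) k := by
        simp only [gramDual, map_sum, map_smul, LinearMap.sum_apply, LinearMap.smul_apply,
          smul_eq_mul, Matrix.mulVec, dotProduct, LinearMap.toMatrix₂_apply, Finset.mul_sum]
        refine Finset.sum_congr rfl fun i _ => Finset.sum_congr rfl fun j _ => ?_
        rw [← hsymm.eq (b k) (b i), RingHom.id_apply, mul_comm]
    _ = d (b k) := by
        rw [Matrix.mulVec_mulVec, Matrix.mul_nonsing_inv _ isUnit_det, Matrix.one_mulVec]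

lemma gramDual_change_basis (hsymm : B.IsSymm) (hsep : B.SeparatingLeft) (d : V →ₗ[K] K) :
    gramDual b B d = gramDual b' B d :=
  LinearMap.ker_eq_bot.1 (LinearMap.separatingLeft_iff_ker_eq_bot.1 hsep)
    ((apply_gramDual b hsymm hsep d).trans (apply_gramDual b' hsymm hsep d).symm)

end Gradient

end Gram

section MatrixSmooth

variable {𝕜 E n : Type*} [NontriviallyNormedField 𝕜] [NormedAddCommGroup E] [NormedSpace 𝕜 E]
  [Fintype n] [DecidableEq n] {k : WithTop ℕ∞} {s : Set E} {A : E → Matrix n n 𝕜}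

lemma contDiffOn_det (hA : ∀ i j, ContDiffOn 𝕜 k (fun y => A y i j) s) :
    ContDiffOn 𝕜 k (fun y => (A y).det) s := by
  simp only [Matrix.det_apply']
  exact ContDiffOn.sum fun σ _ => contDiffOn_const.mul (contDiffOn_prod fun _ _ => hA _ _)

lemma contDiffOn_matrix_inv (hA : ∀ i j, ContDiffOn 𝕜 k (fun y => A y i j) s)
    (hdet : ∀ y ∈ s, (A y).det ≠ 0) (i j : n) :
    ContDiffOn 𝕜 k (fun y => (A y)⁻¹ i j) s := by
  have adjugate_smooth : ContDiffOn 𝕜 k (fun y => (A y).adjugate i j) s := by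
    simp only [Matrix.adjugate_apply]
    refine contDiffOn_det fun a b => ?_
    by_cases hab : a = j
    · simp only [hab, Matrix.updateRow_self]
      exact contDiffOn_const
    · simp only [Matrix.updateRow_ne hab]
      exact hA a b
  simp only [Matrix.inv_def, Matrix.smul_apply, Ring.inverse_eq_inv', smul_eq_mul]
  exact ((contDiffOn_det hA).inv hdet).mul adjugate_smooth

end MatrixSmooth

/-! ### The metric in a chart -/

section Chart

open LinearMap (toMatrix₂)
open Module (Basis)

variable {M : Type*} [TopologicalSpace M] [ChartedSpace E6 M]
  {e : OpenPartialHomeomorph M E6} {y : E6}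

lemma mdifferentiable_of_mem_maximalAtlas (he : e ∈ IsManifold.maximalAtlas (𝓡 6) ∞ M) :
    e.MDifferentiable (𝓡 6) (𝓡 6) :=
  ⟨(contMDiffOn_of_mem_maximalAtlas he).mdifferentiableOn (by simp),
    (contMDiffOn_symm_of_mem_maximalAtlas he).mdifferentiableOn (by simp)⟩

/-- The standard basis `∂_i` of `ℝ⁶`, as a `Basis`. -/
def stdBasis : Basis (Fin 6) ℝ E6 := (EuclideanSpace.basisFun (Fin 6) ℝ).toBasis

lemma stdBasis_apply (i : Fin 6) : stdBasis i = stdVec i := by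
  simp only [stdBasis, OrthonormalBasis.coe_toBasis, EuclideanSpace.basisFun_apply, stdVec]

/-- The standard basis of `T_xM`, which is by definition a copy of `ℝ⁶`. -/
def tangentBasis (x : M) : Basis (Fin 6) ℝ (TangentSpace (𝓡 6) x) := stdBasis

lemma tangentBasis_apply (x : M) (i : Fin 6) :
    tangentBasis x i = (stdVec i : TangentSpace (𝓡 6) x) := stdBasis_apply i

/-- The derivative `w ↦ ∂_w` of the inverse of a chart. -/
def chartTangentEquiv (he : e ∈ IsManifold.maximalAtlas (𝓡 6) ∞ M) (hy : y ∈ e.target) :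
    E6 ≃ₗ[ℝ] TangentSpace (𝓡 6) (e.symm y) :=
  ((mdifferentiable_of_mem_maximalAtlas he).symm.mfderiv hy).toLinearEquiv

lemma chartTangentEquiv_apply (he : e ∈ IsManifold.maximalAtlas (𝓡 6) ∞ M) (hy : y ∈ e.target)
    (w : E6) : chartTangentEquiv he hy w = chartVec e y w := rfl

/-- The coordinate frame `∂_1, …, ∂_6` of a chart. -/
def chartBasis (he : e ∈ IsManifold.maximalAtlas (𝓡 6) ∞ M) (hy : y ∈ e.target) :
    Basis (Fin 6) ℝ (TangentSpace (𝓡 6) (e.symm y)) :=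
  stdBasis.map (chartTangentEquiv he hy)

lemma chartBasis_apply (he : e ∈ IsManifold.maximalAtlas (𝓡 6) ∞ M) (hy : y ∈ e.target)
    (i : Fin 6) : chartBasis he hy i = chartVec e y (stdVec i) := by
  rw [chartBasis, Basis.map_apply, chartTangentEquiv_apply, stdBasis_apply]

/-- The coordinate expression of a vector field in a chart. -/
def chartField (e : OpenPartialHomeomorph M E6) (X : (x : M) → TangentSpace (𝓡 6) x) (y : E6) :
    E6 :=
  mfderiv (𝓡 6) (𝓡 6) e (e.symm y) (X (e.symm y))

lemma chartField_eq_of_eq_chartVec (he : e ∈ IsManifold.maximalAtlas (𝓡 6) ∞ M)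
    (hy : y ∈ e.target) {X : (x : M) → TangentSpace (𝓡 6) x} {w : E6}
    (hX : X (e.symm y) = chartVec e y w) : chartField e X y = w :=
  (congrArg (mfderiv (𝓡 6) (𝓡 6) e (e.symm y)) hX).trans
    (congrArg (fun L => L w) ((mdifferentiable_of_mem_maximalAtlas he).comp_symm_deriv hy))

lemma dReal_chartVec (he : e ∈ IsManifold.maximalAtlas (𝓡 6) ∞ M) (hy : y ∈ e.target)
    {f : M → ℝ} (hf : MDifferentiableAt (𝓡 6) 𝓘(ℝ, ℝ) f (e.symm y)) (w : E6) :
    dReal f (e.symm y) (chartVec e y w) = fderiv ℝ (fun z => f (e.symm z)) y w := by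
  have chain :=
    mfderiv_comp y hf ((mdifferentiable_of_mem_maximalAtlas he).mdifferentiableAt_symm hy)
  rw [mfderiv_eq_fderiv] at chain
  exact (congrArg (fun L => L w) chain).symm

variable [IsManifold (𝓡 6) ∞ M] (g : SmoothMetric M)

/-- The metric at `x`, as a bilinear form on `T_xM`. -/
def metricForm (x : M) : TangentSpace (𝓡 6) x →ₗ[ℝ] TangentSpace (𝓡 6) x →ₗ[ℝ] ℝ :=
  (g.inner x).toLinearMap₁₂

lemma metricForm_apply (x : M) (v w : TangentSpace (𝓡 6) x) :
    metricForm g x v w = g.inner x v w := rfl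

lemma metricForm_isSymm (x : M) : (metricForm g x).IsSymm := ⟨g.symm x⟩

lemma metricForm_separatingLeft (x : M) : (metricForm g x).SeparatingLeft := fun v hv =>
  by_contra fun hne => (g.pos x v hne).ne' (hv v)

lemma gramAt_eq_toMatrix₂ (x : M) :
    gramAt g x = toMatrix₂ (tangentBasis x) (tangentBasis x) (metricForm g x) := by
  ext i j
  rw [LinearMap.toMatrix₂_apply, tangentBasis_apply, tangentBasis_apply]
  rfl

lemma chartGram_eq_toMatrix₂ (he : e ∈ IsManifold.maximalAtlas (𝓡 6) ∞ M) (hy : y ∈ e.target) :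
    chartGram g e y =
      toMatrix₂ (chartBasis he hy) (chartBasis he hy) (metricForm g (e.symm y)) := by
  ext i j
  rw [LinearMap.toMatrix₂_apply, chartBasis_apply, chartBasis_apply]
  rfl

lemma det_chartGram_ne_zero (he : e ∈ IsManifold.maximalAtlas (𝓡 6) ∞ M) (hy : y ∈ e.target) :
    (chartGram g e y).det ≠ 0 := by
  rw [chartGram_eq_toMatrix₂ g he hy]
  exact (LinearMap.separatingLeft_iff_det_ne_zero _).1 (metricForm_separatingLeft g _)

lemma chartGram_transpose (e : OpenPartialHomeomorph M E6) (y : E6) :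
    (chartGram g e y).transpose = chartGram g e y := by
  ext i j
  exact g.symm _ _ _

lemma formNormSq_chart (he : e ∈ IsManifold.maximalAtlas (𝓡 6) ∞ M) (hy : y ∈ e.target) {p : ℕ}
    (F : DiffForm M p) :
    formNormSq g F (e.symm y) = (1 / (p.factorial : ℝ)) *
      ∑ i : Fin p → Fin 6, ∑ j : Fin p → Fin 6, (∏ k, (chartGram g e y)⁻¹ (i k) (j k)) *
        F.comp e (fun k => stdVec (i k)) y * F.comp e (fun k => stdVec (j k)) y := by
  have change := gramContraction_change_basis (tangentBasis (e.symm y)) (chartBasis he hy)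
    (metricForm g (e.symm y)) (F (e.symm y)).toAlternatingMap.toMultilinearMap
  simp only [gramContraction, ← gramAt_eq_toMatrix₂, ← chartGram_eq_toMatrix₂, Function.comp_def,
    tangentBasis_apply, chartBasis_apply] at change
  exact congrArg (1 / (p.factorial : ℝ) * ·) change

lemma grad_eq_gramDual (f : M → ℝ) (x : M) :
    grad g f x = gramDual (tangentBasis x) (metricForm g x) (dReal f x).toLinearMap := by
  simp only [gramDual, ← gramAt_eq_toMatrix₂, tangentBasis_apply]
  rfl

lemma inner_grad (f : M → ℝ) (x : M) (X : TangentSpace (𝓡 6) x) :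
    g.inner x (grad g f x) X = dReal f x X := by
  rw [← metricForm_apply, grad_eq_gramDual,
    apply_gramDual _ (metricForm_isSymm g x) (metricForm_separatingLeft g x)]
  rfl

/-- The vector `g^{ij} (∂_j f) ∂_i` of `ℝ⁶` that represents the gradient in a chart. -/
def chartGrad (f : M → ℝ) (e : OpenPartialHomeomorph M E6) (y : E6) : E6 :=
  ∑ i, ∑ j, ((chartGram g e y)⁻¹ i j * fderiv ℝ (fun z => f (e.symm z)) y (stdVec j)) • stdVec i

lemma chartGrad_apply (f : M → ℝ) (e : OpenPartialHomeomorph M E6) (y : E6) (i : Fin 6) :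
    chartGrad g f e y i = ∑ j, (chartGram g e y)⁻¹ i j *
      fderiv ℝ (fun z => f (e.symm z)) y (stdVec j) := by
  simp [chartGrad, stdVec, ← Finset.sum_smul, Pi.single_apply]

lemma grad_eq_chartVec (he : e ∈ IsManifold.maximalAtlas (𝓡 6) ∞ M) (hy : y ∈ e.target)
    {f : M → ℝ} (hf : MDifferentiableAt (𝓡 6) 𝓘(ℝ, ℝ) f (e.symm y)) :
    grad g f (e.symm y) = chartVec e y (chartGrad g f e y) := by
  rw [grad_eq_gramDual, gramDual_change_basis _ (chartBasis he hy) (metricForm_isSymm g _)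
    (metricForm_separatingLeft g _), ← chartTangentEquiv_apply he hy]
  simp only [gramDual, chartGrad, ← chartGram_eq_toMatrix₂, chartBasis_apply, map_sum, map_smul,
    chartTangentEquiv_apply, ContinuousLinearMap.coe_coe, dReal_chartVec he hy hf]

lemma chartCoord_grad (he : e ∈ IsManifold.maximalAtlas (𝓡 6) ∞ M) (hy : y ∈ e.target)
    {f : M → ℝ} (hf : MDifferentiableAt (𝓡 6) 𝓘(ℝ, ℝ) f (e.symm y)) (i : Fin 6) :
    chartCoord e (grad g f) i y = ∑ j, (chartGram g e y)⁻¹ i j *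
      fderiv ℝ (fun z => f (e.symm z)) y (stdVec j) :=
  (congrArg (fun w : E6 => w i)
    (chartField_eq_of_eq_chartVec he hy (grad_eq_chartVec g he hy hf))).trans
    (chartGrad_apply g f e y i)

lemma inner_grad_grad_chart (he : e ∈ IsManifold.maximalAtlas (𝓡 6) ∞ M) (hy : y ∈ e.target)
    {f : M → ℝ} (hf : MDifferentiableAt (𝓡 6) 𝓘(ℝ, ℝ) f (e.symm y)) :
    g.inner (e.symm y) (grad g f (e.symm y)) (grad g f (e.symm y))
      = ∑ i, ∑ j, (chartGram g e y)⁻¹ i j * fderiv ℝ (fun z => f (e.symm z)) y (stdVec j) *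
        fderiv ℝ (fun z => f (e.symm z)) y (stdVec i) := by
  rw [inner_grad, grad_eq_chartVec g he hy hf, dReal_chartVec he hy hf, chartGrad]
  simp only [map_sum, map_smul, smul_eq_mul]

lemma contMDiffOn_chartVec (he : e ∈ IsManifold.maximalAtlas (𝓡 6) ∞ M) (w : E6) :
    ContMDiffOn (𝓡 6) (𝓡 6).tangent ∞
      (fun y => (⟨e.symm y, chartVec e y w⟩ : TangentBundle (𝓡 6) M)) e.target := by
  have tangentMap_smooth := (contMDiffOn_symm_of_mem_maximalAtlas he).contMDiffOn_tangentMapWithin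
    (m := ∞) (by simp) e.open_target.uniqueMDiffOn
  have const_smooth :
      ContMDiff (𝓡 6) (𝓡 6).tangent ∞ (fun y : E6 => (⟨y, w⟩ : TangentBundle (𝓡 6) E6)) :=
    contMDiff_vectorSpace_iff_contDiff.2 contDiff_const
  refine (tangentMap_smooth.comp (s := e.target) const_smooth.contMDiffOn
    fun y hy => hy).congr fun y hy => ?_
  simp only [Function.comp_apply, tangentMapWithin, chartVec]
  rw [mfderivWithin_of_isOpen e.open_target hy]

lemma contDiffOn_chartGram (he : e ∈ IsManifold.maximalAtlas (𝓡 6) ∞ M) (i j : Fin 6) :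
    ContDiffOn ℝ ∞ (fun y => chartGram g e y i j) e.target := by
  intro y hy
  have symm_smooth : ContMDiffWithinAt (𝓡 6) (𝓡 6) ∞ e.symm e.target y :=
    contMDiffOn_symm_of_mem_maximalAtlas he y hy
  have pairing_smooth : ContMDiffWithinAt (𝓡 6) ((𝓡 6).prod 𝓘(ℝ)) ∞
      (fun m => Bundle.TotalSpace.mk' ℝ (E := Bundle.Trivial M ℝ) (e.symm m)
        (g.inner (e.symm m) (chartVec e m (stdVec i)) (chartVec e m (stdVec j)))) e.target y := by
    apply ContMDiffWithinAt.clm_bundle_apply₂ (F₁ := E6) (F₂ := E6)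
    · exact ContMDiffAt.comp_contMDiffWithinAt y g.contMDiff.contMDiffAt symm_smooth
    · exact contMDiffOn_chartVec he (stdVec i) y hy
    · exact contMDiffOn_chartVec he (stdVec j) y hy
  simp only [Bundle.contMDiffWithinAt_totalSpace] at pairing_smooth
  exact pairing_smooth.2.contDiffWithinAt

lemma contDiffOn_chartGram_inv (he : e ∈ IsManifold.maximalAtlas (𝓡 6) ∞ M) (i j : Fin 6) :
    ContDiffOn ℝ ∞ (fun y => (chartGram g e y)⁻¹ i j) e.target :=
  contDiffOn_matrix_inv (contDiffOn_chartGram g he) (fun _ hy => det_chartGram_ne_zero g he hy) i j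

end Chart

/-! ### Invariance of the divergence under changes of coordinates -/

section CoordinateDivergence

open LinearMap (toMatrix)
open Module (Basis)
open scoped Matrix

section Congruence

variable {R n : Type*} [CommRing R] [Fintype n] [DecidableEq n]

lemma trace_inv_mul_transpose {S : Matrix n n R} (hS : Sᵀ = S) (A : Matrix n n R) :
    (S⁻¹ * Aᵀ).trace = (S⁻¹ * A).trace := by
  rw [← Matrix.trace_transpose, Matrix.transpose_mul, Matrix.transpose_transpose,
    Matrix.transpose_nonsing_inv, hS, Matrix.trace_mul_comm]

lemma trace_inv_mul_congruence {G J : Matrix n n R} (hG : IsUnit G.det) (hJ : IsUnit J.det)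
    (hsymm : Gᵀ = G) (A D : Matrix n n R) :
    ((Jᵀ * G * J)⁻¹ * (Aᵀ * G * J + Jᵀ * D * J + Jᵀ * G * A)).trace
      = (G⁻¹ * D).trace + 2 * (J⁻¹ * A).trace := by
  have hJT : IsUnit Jᵀ.det := by rwa [Matrix.det_transpose]
  have congruence_symm : (Jᵀ * G * J)ᵀ = Jᵀ * G * J := by
    simp only [Matrix.transpose_mul, Matrix.transpose_transpose, hsymm, Matrix.mul_assoc]
  have congruence_inv : (Jᵀ * G * J)⁻¹ = J⁻¹ * G⁻¹ * Jᵀ⁻¹ := by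
    rw [Matrix.mul_inv_rev, Matrix.mul_inv_rev, Matrix.mul_assoc]
  have first_term : Aᵀ * G * J = (Jᵀ * G * A)ᵀ := by
    simp only [Matrix.transpose_mul, Matrix.transpose_transpose, hsymm, Matrix.mul_assoc]
  have middle_term : (Jᵀ * G * J)⁻¹ * (Jᵀ * D * J) = J⁻¹ * (G⁻¹ * D * J) := by
    rw [congruence_inv]
    simp only [Matrix.mul_assoc, Matrix.nonsing_inv_mul_cancel_left _ _ hJT]
  have last_term : (Jᵀ * G * J)⁻¹ * (Jᵀ * G * A) = J⁻¹ * A := by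
    rw [congruence_inv]
    simp only [Matrix.mul_assoc, Matrix.nonsing_inv_mul_cancel_left _ _ hJT,
      Matrix.nonsing_inv_mul_cancel_left _ _ hG]
  rw [first_term, Matrix.mul_add, Matrix.mul_add, Matrix.trace_add, Matrix.trace_add,
    trace_inv_mul_transpose congruence_symm, middle_term, last_term,
    Matrix.trace_mul_comm J⁻¹ (G⁻¹ * D * J), Matrix.mul_nonsing_inv_cancel_right _ _ hJ]
  ring

end Congruence

variable {E l m n : Type*} [NormedAddCommGroup E] [NormedSpace ℝ E]

lemma hasFDerivAt_fderiv {Φ : E → E} {y : E} (hΦ : ContDiffAt ℝ 2 Φ y) :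
    HasFDerivAt (fderiv ℝ Φ) (fderiv ℝ (fderiv ℝ Φ) y) y :=
  ((hΦ.fderiv_right (m := 1) le_rfl).differentiableAt one_ne_zero).hasFDerivAt

/-- The entrywise derivative of a matrix-valued function in the direction `w`. -/
def matrixDeriv (A : E → Matrix m n ℝ) (y w : E) : Matrix m n ℝ :=
  Matrix.of fun i j => fderiv ℝ (fun z => A z i j) y w

lemma matrixDeriv_congr {A B : E → Matrix m n ℝ} {y : E} (h : A =ᶠ[𝓝 y] B) (w : E) :
    matrixDeriv A y w = matrixDeriv B y w := by
  ext i j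
  have entry_eq : (fun z => A z i j) =ᶠ[𝓝 y] fun z => B z i j :=
    h.mono fun z hz => congrFun (congrFun hz i) j
  exact congrArg (fun L : E →L[ℝ] ℝ => L w) entry_eq.fderiv_eq

lemma matrixDeriv_transpose (A : E → Matrix m n ℝ) (y w : E) :
    matrixDeriv (fun z => (A z)ᵀ) y w = (matrixDeriv A y w)ᵀ := rfl

lemma matrixDeriv_comp {A : E → Matrix m n ℝ} {Φ : E → E} {y : E}
    (hA : ∀ i j, DifferentiableAt ℝ (fun z => A z i j) (Φ y)) (hΦ : DifferentiableAt ℝ Φ y)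
    (w : E) :
    matrixDeriv (fun z => A (Φ z)) y w = matrixDeriv A (Φ y) (fderiv ℝ Φ y w) := by
  ext i j
  exact congrArg (fun L => L w) (fderiv_comp y (hA i j) hΦ)

variable [Fintype m]

lemma differentiableAt_matrix_mul {A : E → Matrix l m ℝ} {B : E → Matrix m n ℝ} {y : E}
    (hA : ∀ i j, DifferentiableAt ℝ (fun z => A z i j) y)
    (hB : ∀ i j, DifferentiableAt ℝ (fun z => B z i j) y) (i : l) (j : n) :
    DifferentiableAt ℝ (fun z => (A z * B z) i j) y := by
  simp only [Matrix.mul_apply]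
  exact DifferentiableAt.fun_sum fun k _ => (hA i k).mul (hB k j)

lemma matrixDeriv_mul {A : E → Matrix l m ℝ} {B : E → Matrix m n ℝ} {y : E}
    (hA : ∀ i j, DifferentiableAt ℝ (fun z => A z i j) y)
    (hB : ∀ i j, DifferentiableAt ℝ (fun z => B z i j) y) (w : E) :
    matrixDeriv (fun z => A z * B z) y w
      = matrixDeriv A y w * B y + A y * matrixDeriv B y w := by
  ext i j
  have product_rule := HasFDerivAt.fun_sum (u := Finset.univ) fun k _ =>
    (hA i k).hasFDerivAt.fun_mul (hB k j).hasFDerivAt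
  simp only [matrixDeriv, Matrix.add_apply, Matrix.mul_apply, Matrix.of_apply,
    product_rule.fderiv, _root_.sum_apply, _root_.add_apply, _root_.smul_apply, smul_eq_mul,
    Finset.sum_add_distrib]
  rw [add_comm]
  exact congrArg₂ _ (Finset.sum_congr rfl fun _ _ => mul_comm _ _) rfl

section Jacobian

variable {ι : Type*} [Fintype ι] [DecidableEq ι] (b : Basis ι ℝ E)

lemma hasFDerivAt_toMatrix {L : E → E →L[ℝ] E} {y : E} {L' : E →L[ℝ] E →L[ℝ] E}
    (hL : HasFDerivAt L L' y) (i j : ι) :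
    HasFDerivAt (fun z => toMatrix b b (L z : E →ₗ[ℝ] E) i j)
      (((ContinuousLinearMap.proj i).comp (b.equivFunL : E →L[ℝ] ι → ℝ)).comp
        ((ContinuousLinearMap.apply ℝ E (b j)).comp L')) y := by
  simp only [LinearMap.toMatrix_apply]
  exact ((ContinuousLinearMap.proj i).comp (b.equivFunL : E →L[ℝ] ι → ℝ)).hasFDerivAt.comp y
    ((ContinuousLinearMap.apply ℝ E (b j)).hasFDerivAt.comp y hL)

/-- The Jacobian matrix of a map, in a basis. -/
def jacobian (Φ : E → E) (z : E) : Matrix ι ι ℝ := toMatrix b b (fderiv ℝ Φ z : E →ₗ[ℝ] E)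

variable {Φ : E → E} {y : E}

lemma differentiableAt_jacobian (hΦ : ContDiffAt ℝ 2 Φ y) (i j : ι) :
    DifferentiableAt ℝ (fun z => jacobian b Φ z i j) y :=
  (hasFDerivAt_toMatrix b (hasFDerivAt_fderiv hΦ) i j).differentiableAt

lemma matrixDeriv_jacobian (hΦ : ContDiffAt ℝ 2 Φ y) (w : E) :
    matrixDeriv (jacobian b Φ) y w
      = toMatrix b b (fderiv ℝ (fderiv ℝ Φ) y w : E →ₗ[ℝ] E) := by
  ext i j
  refine (congrArg (fun L => L w)
    (hasFDerivAt_toMatrix b (hasFDerivAt_fderiv hΦ) i j).fderiv).trans ?_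
  rw [LinearMap.toMatrix_apply]
  rfl

lemma trace_inv_mul_matrixDeriv_congruence (hΦ : ContDiffAt ℝ 2 Φ y) {G G' : E → Matrix ι ι ℝ}
    (hJ : (jacobian b Φ y).det ≠ 0) (hdet : (G (Φ y)).det ≠ 0) (hsymm : (G (Φ y))ᵀ = G (Φ y))
    (hG : ∀ i j, DifferentiableAt ℝ (fun z => G z i j) (Φ y))
    (hG' : G' =ᶠ[𝓝 y] fun z => (jacobian b Φ z)ᵀ * G (Φ z) * jacobian b Φ z) (w : E) :
    ((G' y)⁻¹ * matrixDeriv G' y w).trace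
      = ((G (Φ y))⁻¹ * matrixDeriv G (Φ y) (fderiv ℝ Φ y w)).trace
        + 2 * ((jacobian b Φ y)⁻¹ * matrixDeriv (jacobian b Φ) y w).trace := by
  have hΦ' := hΦ.differentiableAt two_ne_zero
  have hGΦ : ∀ i j, DifferentiableAt ℝ (fun z => G (Φ z) i j) y := fun i j =>
    (hG i j).comp y hΦ'
  have hJd := differentiableAt_jacobian b hΦ
  have hJTd : ∀ i j, DifferentiableAt ℝ (fun z => (jacobian b Φ z)ᵀ i j) y := fun i j => hJd j i
  have product_rule : matrixDeriv G' y w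
      = (matrixDeriv (jacobian b Φ) y w)ᵀ * G (Φ y) * jacobian b Φ y
        + (jacobian b Φ y)ᵀ * matrixDeriv G (Φ y) (fderiv ℝ Φ y w) * jacobian b Φ y
        + (jacobian b Φ y)ᵀ * G (Φ y) * matrixDeriv (jacobian b Φ) y w := by
    rw [matrixDeriv_congr hG', matrixDeriv_mul (differentiableAt_matrix_mul hJTd hGΦ) hJd,
      matrixDeriv_mul hJTd hGΦ, matrixDeriv_transpose, matrixDeriv_comp hG hΦ', Matrix.add_mul]
  rw [product_rule, hG'.self_of_nhds, trace_inv_mul_congruence hdet.isUnit hJ.isUnit hsymm]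

lemma fderiv_comp_eq_of_pushforward (hΦ : ContDiffAt ℝ 2 Φ y) {X X' : E → E}
    (hX : DifferentiableAt ℝ X (Φ y)) (hX' : DifferentiableAt ℝ X' y)
    (hXX' : (fun z => X (Φ z)) =ᶠ[𝓝 y] fun z => fderiv ℝ Φ z (X' z)) :
    (fderiv ℝ X (Φ y)).comp (fderiv ℝ Φ y)
      = fderiv ℝ (fderiv ℝ Φ) y (X' y) + (fderiv ℝ Φ y).comp (fderiv ℝ X' y) := by
  have symm : IsSymmSndFDerivAt ℝ Φ y :=
    hΦ.isSymmSndFDerivAt (by rw [minSmoothness_of_isRCLikeNormedField])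
  have chain : fderiv ℝ (fun z => X (Φ z)) y = (fderiv ℝ X (Φ y)).comp (fderiv ℝ Φ y) :=
    fderiv_comp y hX (hΦ.differentiableAt two_ne_zero)
  rw [← chain, hXX'.fderiv_eq, ((hasFDerivAt_fderiv hΦ).clm_apply hX'.hasFDerivAt).fderiv, add_comm]
  ext v
  exact congrArg (· + _) (symm v (X' y))

lemma trace_fderiv_pushforward (hΦ : ContDiffAt ℝ 2 Φ y) (hJ : (jacobian b Φ y).det ≠ 0)
    {X X' : E → E} (hX : DifferentiableAt ℝ X (Φ y)) (hX' : DifferentiableAt ℝ X' y)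
    (hXX' : (fun z => X (Φ z)) =ᶠ[𝓝 y] fun z => fderiv ℝ Φ z (X' z)) :
    LinearMap.trace ℝ E (fderiv ℝ X (Φ y))
      = ((jacobian b Φ y)⁻¹ * matrixDeriv (jacobian b Φ) y (X' y)).trace
        + LinearMap.trace ℝ E (fderiv ℝ X' y) := by
  have matrix_eq : toMatrix b b (fderiv ℝ X (Φ y) : E →ₗ[ℝ] E) * jacobian b Φ y
      = matrixDeriv (jacobian b Φ) y (X' y)
        + jacobian b Φ y * toMatrix b b (fderiv ℝ X' y : E →ₗ[ℝ] E) := by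
    rw [matrixDeriv_jacobian b hΦ, jacobian, ← LinearMap.toMatrix_comp, ← LinearMap.toMatrix_comp,
      ← map_add, ← ContinuousLinearMap.toLinearMap_comp,
      fderiv_comp_eq_of_pushforward hΦ hX hX' hXX']
    rfl
  rw [LinearMap.trace_eq_matrix_trace ℝ b, LinearMap.trace_eq_matrix_trace ℝ b,
    ← Matrix.nonsing_inv_mul_cancel_left _ (toMatrix b b (fderiv ℝ X' y : E →ₗ[ℝ] E)) hJ.isUnit,
    ← Matrix.trace_add, ← Matrix.mul_add, ← matrix_eq, Matrix.trace_mul_comm,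
    Matrix.mul_nonsing_inv_cancel_right _ _ hJ.isUnit]

/-- The coordinate expression `∂_i X^i + ½ g^{ij} X^k ∂_k g_{ij}` of the divergence of the vector
field `X` for the metric `G`. -/
def coordDiv (G : E → Matrix ι ι ℝ) (X : E → E) (y : E) : ℝ :=
  LinearMap.trace ℝ E (fderiv ℝ X y) + 1 / 2 * ((G y)⁻¹ * matrixDeriv G y (X y)).trace

/-- Both terms change by the trace of `J⁻¹ ∂_X J`, with opposite signs. -/
lemma coordDiv_change_coordinates (hΦ : ContDiffAt ℝ 2 Φ y) {G G' : E → Matrix ι ι ℝ}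
    {X X' : E → E} (hJ : (jacobian b Φ y).det ≠ 0) (hdet : (G (Φ y)).det ≠ 0)
    (hsymm : (G (Φ y))ᵀ = G (Φ y)) (hG : ∀ i j, DifferentiableAt ℝ (fun z => G z i j) (Φ y))
    (hX : DifferentiableAt ℝ X (Φ y)) (hX' : DifferentiableAt ℝ X' y)
    (hG' : G' =ᶠ[𝓝 y] fun z => (jacobian b Φ z)ᵀ * G (Φ z) * jacobian b Φ z)
    (hXX' : (fun z => X (Φ z)) =ᶠ[𝓝 y] fun z => fderiv ℝ Φ z (X' z)) :
    coordDiv G X (Φ y) = coordDiv G' X' y := by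
  have hXy : X (Φ y) = fderiv ℝ Φ y (X' y) := hXX'.self_of_nhds
  rw [coordDiv, coordDiv, hXy, trace_fderiv_pushforward b hΦ hJ hX hX' hXX',
    trace_inv_mul_matrixDeriv_congruence b hΦ hJ hdet hsymm hG hG']
  ring

end Jacobian

end CoordinateDivergence

section ChartDivergence

variable {M : Type*} [TopologicalSpace M] {e e' : OpenPartialHomeomorph M E6} {z : E6}

lemma eventually_mem_chart_inter (hz : z ∈ e'.target) (hz' : e'.symm z ∈ e.source) :
    ∀ᶠ y in 𝓝 z, y ∈ e'.target ∧ e'.symm y ∈ e.source :=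
  Filter.Eventually.and (e'.open_target.mem_nhds hz)
    ((e'.continuousAt_symm hz).eventually (e.open_source.mem_nhds hz'))

variable [ChartedSpace E6 M] (he : e ∈ IsManifold.maximalAtlas (𝓡 6) ∞ M)
  (he' : e' ∈ IsManifold.maximalAtlas (𝓡 6) ∞ M)

include he he'

lemma contDiffAt_chart_change (hz : z ∈ e'.target) (hz' : e'.symm z ∈ e.source) :
    ContDiffAt ℝ ∞ (fun y => e (e'.symm y)) z := by
  have smooth := (contMDiffOn_of_mem_maximalAtlas he).contMDiffAt (e.open_source.mem_nhds hz')
  have smooth_symm :=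
    (contMDiffOn_symm_of_mem_maximalAtlas he').contMDiffAt (e'.open_target.mem_nhds hz)
  exact (smooth.comp z smooth_symm).contDiffAt

lemma chartVec_chart_change (hz : z ∈ e'.target) (hz' : e'.symm z ∈ e.source) (w : E6) :
    (show E6 from chartVec e' z w) =
      (show E6 from chartVec e (e (e'.symm z)) (fderiv ℝ (fun y => e (e'.symm y)) z w)) := by
  have eventually_eq : (e'.symm : E6 → M) =ᶠ[𝓝 z] e.symm ∘ fun y => e (e'.symm y) := by
    filter_upwards [eventually_mem_chart_inter hz hz'] with y hy
    exact (e.left_inv hy.2).symm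
  have change_diff := (contDiffAt_chart_change he he' hz hz').differentiableAt (by simp)
  have chain := mfderiv_comp z ((mdifferentiable_of_mem_maximalAtlas he).mdifferentiableAt_symm
    (e.map_source hz')) change_diff.mdifferentiableAt
  rw [mfderiv_eq_fderiv] at chain
  exact congrArg (fun L : E6 →L[ℝ] E6 => L w) (eventually_eq.mfderiv_eq.trans chain)

lemma chartField_chart_change (hz : z ∈ e'.target) (hz' : e'.symm z ∈ e.source)
    (X : (x : M) → TangentSpace (𝓡 6) x) :
    chartField e X (e (e'.symm z))
      = fderiv ℝ (fun y => e (e'.symm y)) z (chartField e' X z) := by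
  -- The point is generalized because `e.symm (e (e'.symm z))` occurs in the types of both vectors.
  suffices eq_at : ∀ p : M, p = e'.symm z → (show E6 from mfderiv (𝓡 6) (𝓡 6) e p (X p)) =
      fderiv ℝ (fun y => e (e'.symm y)) z (chartField e' X z) from eq_at _ (e.left_inv hz')
  rintro p rfl
  have eventually_eq : (e : M → E6) =ᶠ[𝓝 (e'.symm z)] (fun y => e (e'.symm y)) ∘ e' := by
    filter_upwards [e'.open_source.mem_nhds (e'.map_target hz)] with p hp
    simp only [Function.comp_apply, e'.left_inv hp]
  have change_diff := (contDiffAt_chart_change he he' hz hz').differentiableAt (by simp)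
  rw [← e'.right_inv hz] at change_diff
  have chain := mfderiv_comp (e'.symm z) change_diff.mdifferentiableAt
    ((mdifferentiable_of_mem_maximalAtlas he').mdifferentiableAt (e'.map_target hz))
  rw [mfderiv_eq_fderiv, e'.right_inv hz] at chain
  exact congrArg (fun L : E6 →L[ℝ] E6 => L (X (e'.symm z))) (eventually_eq.mfderiv_eq.trans chain)

omit he he'

variable [IsManifold (𝓡 6) ∞ M] (g : SmoothMetric M)

/-- The metric in a chart, as a field of bilinear forms on `ℝ⁶`. -/
def chartForm (e : OpenPartialHomeomorph M E6) (y : E6) : E6 →ₗ[ℝ] E6 →ₗ[ℝ] ℝ :=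
  let D : E6 →ₗ[ℝ] TangentSpace (𝓡 6) (e.symm y) := (mfderiv (𝓡 6) (𝓡 6) e.symm y).toLinearMap
  (metricForm g (e.symm y)).compl₁₂ D D

lemma chartGram_eq_toMatrix₂_chartForm (e : OpenPartialHomeomorph M E6) (y : E6) :
    chartGram g e y = LinearMap.toMatrix₂ stdBasis stdBasis (chartForm g e y) := by
  ext i j
  rw [LinearMap.toMatrix₂_apply, stdBasis_apply, stdBasis_apply]
  rfl

include he he'

lemma chartForm_chart_change (hz : z ∈ e'.target) (hz' : e'.symm z ∈ e.source) :
    chartForm g e' z = (chartForm g e (e (e'.symm z))).compl₁₂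
      (fderiv ℝ (fun y => e (e'.symm y)) z : E6 →ₗ[ℝ] E6)
      (fderiv ℝ (fun y => e (e'.symm y)) z : E6 →ₗ[ℝ] E6) := by
  have inner_congr : ∀ p q : M, p = q → ∀ v w v' w' : E6, v = v' → w = w' →
      g.inner p (show TangentSpace (𝓡 6) p from v) (show TangentSpace (𝓡 6) p from w) =
      g.inner q (show TangentSpace (𝓡 6) q from v') (show TangentSpace (𝓡 6) q from w') := by
    rintro p q rfl v w v' w' rfl rfl
    rfl
  exact LinearMap.ext₂ fun v w => inner_congr _ _ (e.left_inv hz').symm _ _ _ _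
    (chartVec_chart_change he he' hz hz' v) (chartVec_chart_change he he' hz hz' w)

lemma chartGram_chart_change (hz : z ∈ e'.target) (hz' : e'.symm z ∈ e.source) :
    chartGram g e' z = (jacobian stdBasis (fun y => e (e'.symm y)) z).transpose *
      chartGram g e (e (e'.symm z)) * jacobian stdBasis (fun y => e (e'.symm y)) z := by
  rw [chartGram_eq_toMatrix₂_chartForm, chartForm_chart_change he he' g hz hz',
    LinearMap.toMatrix₂_compl₁₂ stdBasis stdBasis stdBasis stdBasis,
    chartGram_eq_toMatrix₂_chartForm]
  rfl

omit he he'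

lemma chartDiv_eq_coordDiv {X : (x : M) → TangentSpace (𝓡 6) x} {y : E6}
    (hX : DifferentiableAt ℝ (chartField e X) y) :
    chartDiv g e X y = coordDiv (chartGram g e) (chartField e X) y := by
  have trace_eq : ∑ i, fderiv ℝ (chartCoord e X i) y (stdVec i)
      = LinearMap.trace ℝ E6 (fderiv ℝ (chartField e X) y) := by
    rw [LinearMap.trace_eq_matrix_trace ℝ stdBasis, Matrix.trace]
    refine Finset.sum_congr rfl fun i _ => ?_
    have coord_deriv : HasFDerivAt (chartCoord e X i) _ y :=
      (EuclideanSpace.proj (𝕜 := ℝ) i).hasFDerivAt.comp y hX.hasFDerivAt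
    rw [coord_deriv.fderiv, Matrix.diag_apply, LinearMap.toMatrix_apply, stdBasis_apply]
    rfl
  have expand (L : E6 →L[ℝ] ℝ) :
      L (chartField e X y) = ∑ k, chartCoord e X k y * L (stdVec k) := by
    conv_lhs => rw [← stdBasis.sum_repr (chartField e X y)]
    simp only [map_sum, map_smul, stdBasis_apply, smul_eq_mul]
    rfl
  rw [chartDiv, coordDiv, trace_eq, ← trace_inv_mul_transpose (chartGram_transpose g e y),
    ← Matrix.sum_hadamard_eq]
  simp only [Matrix.hadamard_apply, matrixDeriv, Matrix.of_apply, expand, Finset.mul_sum,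
    Finset.sum_mul]
  rw [Finset.sum_comm]
  congr 1
  refine Finset.sum_congr rfl fun i _ => ?_
  rw [Finset.sum_comm]
  refine Finset.sum_congr rfl fun j _ => Finset.sum_congr rfl fun k _ => ?_
  ring

include he he' in
lemma chartDiv_chart_change {X : (x : M) → TangentSpace (𝓡 6) x} (hz : z ∈ e'.target)
    (hz' : e'.symm z ∈ e.source) (hX : DifferentiableAt ℝ (chartField e X) (e (e'.symm z)))
    (hX' : DifferentiableAt ℝ (chartField e' X) z) :
    chartDiv g e X (e (e'.symm z)) = chartDiv g e' X z := by
  have hy : e (e'.symm z) ∈ e.target := e.map_source hz'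
  have det_jacobian_ne_zero : (jacobian stdBasis (fun y => e (e'.symm y)) z).det ≠ 0 := fun h0 =>
    det_chartGram_ne_zero g he' hz <| by
      rw [chartGram_chart_change he he' g hz hz', Matrix.det_mul, h0, mul_zero]
  rw [chartDiv_eq_coordDiv g hX, chartDiv_eq_coordDiv g hX']
  refine coordDiv_change_coordinates stdBasis
    ((contDiffAt_chart_change he he' hz hz').of_le (WithTop.coe_le_coe.2 le_top))
    det_jacobian_ne_zero
    (det_chartGram_ne_zero g he hy) (chartGram_transpose g e _) (fun i j => ?_) hX hX' ?_ ?_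
  · exact ((contDiffOn_chartGram g he i j).contDiffAt (e.open_target.mem_nhds hy)).differentiableAt
      (by simp)
  · filter_upwards [eventually_mem_chart_inter hz hz'] with y hy
    exact chartGram_chart_change he he' g hy.1 hy.2
  · filter_upwards [eventually_mem_chart_inter hz hz'] with y hy
    exact chartField_chart_change he he' hy.1 hy.2 X

include he in
lemma diverg_chart {X : (x : M) → TangentSpace (𝓡 6) x}
    (hX : ∀ e ∈ IsManifold.maximalAtlas (𝓡 6) ∞ M, ∀ y ∈ e.target,
      DifferentiableAt ℝ (chartField e X) y) (hz : z ∈ e.target) :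
    diverg g X (e.symm z) = chartDiv g e X z := by
  have atlas := IsManifold.chart_mem_maximalAtlas (I := 𝓡 6) (n := ∞) (e.symm z)
  have source := mem_chart_source E6 (e.symm z)
  exact chartDiv_chart_change atlas he g hz source
    (hX _ atlas _ ((chartAt E6 (e.symm z)).map_source source)) (hX e he z hz)

end ChartDivergence

/-! ### Families of functions of class `H^σ` on the manifold -/

section Localization

variable {M : Type*} [TopologicalSpace M] [ChartedSpace E6 M] {σ : ℝ}

lemma continuous_mul_of_tsupport_subset {V : Type*} [TopologicalSpace V] {χ f : V → ℝ} {Ω : Set V}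
    (hχ : Continuous χ) (hΩ : IsOpen Ω) (hsub : tsupport χ ⊆ Ω) (hf : ContinuousOn f Ω) :
    Continuous fun y => χ y * f y :=
  (hχ.continuousOn.mul hf).continuous_of_tsupport_subset hΩ
    ((closure_mono (Function.support_mul_subset_left _ _)).trans hsub)

namespace Localizer

lemma continuous_loc (l : Localizer M) {f : M → ℝ} (hf : Continuous f) : Continuous (l.loc f) :=
  continuous_mul_of_tsupport_subset l.smooth.continuous l.chart.open_target l.support
    (hf.comp_continuousOn l.chart.continuousOn_symm)

lemma hasCompactSupport_loc (l : Localizer M) (f : M → ℝ) : HasCompactSupport (l.loc f) :=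
  HasCompactSupport.mul_right l.compact

lemma continuous_locForm (l : Localizer M) {p : ℕ} (w : Fin p → E6) (F : HsForm M p σ) :
    Continuous (l.locForm w F.toForm) :=
  continuous_mul_of_tsupport_subset l.smooth.continuous l.chart.open_target l.support
    (F.continuousOn_comp _ l.chart_mem w)

lemma hasCompactSupport_locForm (l : Localizer M) {p : ℕ} (w : Fin p → E6) (F : DiffForm M p) :
    HasCompactSupport (l.locForm w F) :=
  HasCompactSupport.mul_right l.compact

end Localizer

/-- The `L²` density of the localization of a function of class `H^σ`, whose norm is the `H^σ(ℝ⁶)`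
norm of that localization. -/
def HsFunction.density (l : Localizer M) (f : HsFunction M σ) : Density E6 :=
  (f.memHs l).toLp (besselFourier σ (l.loc f))

lemma HsFunction.continuous_density (l : Localizer M) :
    Continuous (HsFunction.density l : HsFunction M σ → Density E6) :=
  continuous_iInf_dom continuous_induced_dom

lemma HsFunction.synth_density (hσ : (Module.finrank ℝ E6 : ℝ) < 2 * σ) (l : Localizer M)
    (f : HsFunction M σ) (y : E6) : synth hσ (f.density l) y = (l.loc f y : ℂ) :=
  synth_toLp_besselFourier hσ (l.continuous_loc f.continuous_toFun) (l.hasCompactSupport_loc f) _ y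

/-- The `L²` density of a localized component of a form of class `H^σ`, whose norm is the
`H^σ(ℝ⁶)` norm of that component. -/
def HsForm.density {p : ℕ} (l : Localizer M) (w : Fin p → E6) (F : HsForm M p σ) : Density E6 :=
  (F.memHs l w).toLp (besselFourier σ (l.locForm w F.toForm))

lemma HsForm.continuous_density {p : ℕ} (l : Localizer M) (w : Fin p → E6) :
    Continuous (HsForm.density l w : HsForm M p σ → Density E6) :=
  continuous_iInf_dom (i := l) (continuous_iInf_dom (i := w) continuous_induced_dom)

lemma HsForm.synth_density (hσ : (Module.finrank ℝ E6 : ℝ) < 2 * σ) {p : ℕ} (l : Localizer M)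
    (w : Fin p → E6) (F : HsForm M p σ) (y : E6) :
    synth hσ (F.density l w) y = (l.locForm w F.toForm y : ℂ) :=
  synth_toLp_besselFourier hσ (l.continuous_locForm w F)
    (l.hasCompactSupport_locForm w F.toForm) _ y

end Localization

/-- The family `a S` of functions on `M`, with the parameter `S ∈ D`, is of class `H^σ` and depends
continuously on `S`: it does so in every chart. -/
def HsFamily {M X : Type*} [TopologicalSpace M] [ChartedSpace E6 M] [TopologicalSpace X] {σ : ℝ}
    (hσ : (Module.finrank ℝ E6 : ℝ) < 2 * σ) (D : Set X) (a : X → M → ℝ) : Prop :=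
  ∀ e ∈ IsManifold.maximalAtlas (𝓡 6) ∞ M, LocHs e.target hσ D fun S y => a S (e.symm y)

namespace HsFamily

variable {M X : Type*} [TopologicalSpace M] [ChartedSpace E6 M] [TopologicalSpace X] {σ τ : ℝ}
  {hσ : (Module.finrank ℝ E6 : ℝ) < 2 * σ} {hτ : (Module.finrank ℝ E6 : ℝ) < 2 * τ} {D : Set X}
  {a a' : X → M → ℝ}

lemma of_continuousOn {f : X → HsFunction M σ} (hf : ContinuousOn f D) :
    HsFamily hσ D fun S => f S := by
  intro e he χ hχ hc hsub
  let l : Localizer M := ⟨e, he, χ, hχ, hc, hsub⟩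
  exact ⟨fun S => (f S).density l, (HsFunction.continuous_density l).comp_continuousOn hf,
    fun S _ y => (f S).synth_density hσ l y⟩

lemma add (h : HsFamily hσ D a) (h' : HsFamily hσ D a') :
    HsFamily hσ D fun S x => a S x + a' S x :=
  fun e he => (h e he).add (h' e he)

lemma sub (h : HsFamily hσ D a) (h' : HsFamily hσ D a') :
    HsFamily hσ D fun S x => a S x - a' S x :=
  fun e he => (h e he).sub (h' e he) e.open_target

lemma mul (h : HsFamily hσ D a) (h' : HsFamily hσ D a') :
    HsFamily hσ D fun S x => a S x * a' S x :=
  fun e he => (h e he).mul (h' e he) e.open_target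

lemma pow (h : HsFamily hσ D a) (n : ℕ) : HsFamily hσ D fun S x => a S x ^ n :=
  fun e he => (h e he).pow e.open_target n

lemma const_mul (h : HsFamily hσ D a) (c : ℝ) : HsFamily hσ D fun S x => c * a S x :=
  fun e he => (h e he).const_mul e.open_target c

lemma scalar {c : X → ℝ} (hc : ContinuousOn c D) : HsFamily hσ D fun S (_ : M) => c S :=
  fun e _ => LocHs.scalar e.open_target hc

lemma inv (h : HsFamily hσ D a) (hpos : ∀ S ∈ D, ∀ x, 0 < a S x) :
    HsFamily hσ D fun S x => (a S x)⁻¹ :=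
  fun e he => (h e he).inv e.open_target fun S hS _ _ => hpos S hS _

lemma mono (h : HsFamily hσ D a) (hle : τ ≤ σ) : HsFamily hτ D a :=
  fun e he => (h e he).mono hle

section Regularity

variable [IsManifold (𝓡 6) ∞ M]

lemma contMDiff (h : HsFamily hσ D a) (n : ℕ) (hn : (Module.finrank ℝ E6 : ℝ) < 2 * (σ - n))
    {S : X} (hS : S ∈ D) : ContMDiff (𝓡 6) 𝓘(ℝ, ℝ) n (a S) := by
  intro x
  have he := IsManifold.chart_mem_maximalAtlas (I := 𝓡 6) (n := ∞) x
  set e := chartAt E6 x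
  have hx : x ∈ e.source := mem_chart_source E6 x
  have contMDiffAt_local : ContMDiffAt (𝓡 6) 𝓘(ℝ, ℝ) n (fun y => a S (e.symm y)) (e x) :=
    (((h e he).contDiffOn e.open_target n hn hS).contDiffAt
      (e.open_target.mem_nhds (e.map_source hx))).contMDiffAt
  have contMDiffAt_chart : ContMDiffAt (𝓡 6) (𝓡 6) n e x :=
    ((contMDiffOn_of_mem_maximalAtlas he).contMDiffAt (e.open_source.mem_nhds hx)).of_le
      (WithTop.coe_le_coe.2 le_top)
  refine (contMDiffAt_local.comp x contMDiffAt_chart).congr_of_eventuallyEq ?_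
  filter_upwards [e.open_source.mem_nhds hx] with z hz
  rw [Function.comp_apply, e.left_inv hz]

lemma mdifferentiable (h : HsFamily hσ D a) (hn : (Module.finrank ℝ E6 : ℝ) < 2 * (σ - 1))
    {S : X} (hS : S ∈ D) : MDifferentiable (𝓡 6) 𝓘(ℝ, ℝ) (a S) :=
  (h.contMDiff 1 (by simpa using hn) hS).mdifferentiable one_ne_zero

lemma exists_hsFunction (h : HsFamily hσ D a) :
    ∃ A : X → HsFunction M σ, ContinuousOn A D ∧ ∀ S ∈ D, ∀ x, A S x = a S x := by
  classical
  have memHs : ∀ S ∈ D, ∀ l : Localizer M, MemHsEuclidean σ (l.loc (a S)) := by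
    intro S hS l
    obtain ⟨G, -, hG⟩ := h l.chart l.chart_mem l.cutoff l.smooth l.compact l.support
    exact memHsEuclidean_of_synth hσ (l.hasCompactSupport_loc _) (hG S hS)
  refine ⟨fun S => if hS : S ∈ D then
    ⟨a S, (h.contMDiff 0 (by simpa using hσ) hS).continuous, memHs S hS⟩ else 1, ?_, ?_⟩
  · rw [continuousOn_iff_continuous_domRestrict]
    refine continuous_iInf_rng.2 fun l => continuous_induced_rng.2 ?_
    obtain ⟨G, hGc, hG⟩ := h l.chart l.chart_mem l.cutoff l.smooth l.compact l.support
    refine (continuousOn_iff_continuous_domRestrict.1 hGc).congr fun S => ?_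
    refine (toLp_besselFourier_eq_of_synth hσ (l.hasCompactSupport_loc _) (fun y => ?_)
      (HsFunction.memHs _ l)).symm
    simp only [domRestrict_apply, dif_pos S.2]
    exact hG S S.2 y
  · intro S hS x
    simp only [dif_pos hS]

end Regularity

end HsFamily

/-! ### The geometric operators on families -/

lemma HsForm.locHs_comp {M X : Type*} [TopologicalSpace M] [ChartedSpace E6 M] [TopologicalSpace X]
    {σ : ℝ} {hσ : (Module.finrank ℝ E6 : ℝ) < 2 * σ} {D : Set X} {p : ℕ} {F : X → HsForm M p σ}
    (hF : ContinuousOn F D) {e : OpenPartialHomeomorph M E6}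
    (he : e ∈ IsManifold.maximalAtlas (𝓡 6) ∞ M) (w : Fin p → E6) :
    LocHs e.target hσ D fun S y => (F S).toForm.comp e w y := by
  intro χ hχ hc hsub
  let l : Localizer M := ⟨e, he, χ, hχ, hc, hsub⟩
  exact ⟨fun S => (F S).density l w, (HsForm.continuous_density l w).comp_continuousOn hF,
    fun S _ y => (F S).synth_density hσ l w y⟩

namespace HsFamily

variable {M X : Type*} [TopologicalSpace M] [ChartedSpace E6 M] [IsManifold (𝓡 6) ∞ M]
  [TopologicalSpace X] {σ τ : ℝ} {hσ : (Module.finrank ℝ E6 : ℝ) < 2 * σ}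
  {hτ : (Module.finrank ℝ E6 : ℝ) < 2 * τ} {hσ' : (Module.finrank ℝ E6 : ℝ) < 2 * (σ - 1)}
  {D : Set X} {a a' : X → M → ℝ} (g : SmoothMetric M)

protected lemma formNormSq {p : ℕ} {F : X → HsForm M p σ} (hF : ContinuousOn F D) :
    HsFamily hσ D fun S x => formNormSq g (F S).toForm x := by
  intro e he
  have hΩ := e.open_target
  have locHs_summand : ∀ i j : Fin p → Fin 6, LocHs e.target hσ D fun S y =>
      (∏ k, (chartGram g e y)⁻¹ (i k) (j k)) * (F S).toForm.comp e (fun k => stdVec (i k)) y *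
        (F S).toForm.comp e (fun k => stdVec (j k)) y := fun i j =>
    ((LocHs.smooth hΩ (contDiffOn_prod fun k _ => contDiffOn_chartGram_inv g he (i k) (j k))).mul
      (HsForm.locHs_comp hF he fun k => stdVec (i k)) hΩ).mul
      (HsForm.locHs_comp hF he fun k => stdVec (j k)) hΩ
  exact ((LocHs.sum hΩ _ fun i _ => LocHs.sum hΩ _ fun j _ => locHs_summand i j).const_mul hΩ
    (1 / (p.factorial : ℝ))).congr fun S _ y hy => (formNormSq_chart g he hy _).symm

lemma inner_grad_grad (h : HsFamily hσ D a) :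
    HsFamily hσ' D fun S x => g.inner x (grad g (a S) x) (grad g (a S) x) := by
  intro e he
  have hΩ := e.open_target
  have locHs_fderiv := fun i => (h e he).fderiv_apply (hσ' := hσ') hΩ (stdVec i)
  exact (LocHs.sum hΩ _ fun i _ => LocHs.sum hΩ _ fun j _ =>
    ((LocHs.smooth hΩ (contDiffOn_chartGram_inv g he i j)).mul (locHs_fderiv j) hΩ).mul
      (locHs_fderiv i) hΩ).congr
    fun S hS y hy => (inner_grad_grad_chart g he hy (h.mdifferentiable hσ' hS _)).symm

lemma locHs_chartCoord_smul_grad (h : HsFamily hσ D a) (h' : HsFamily hσ D a')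
    {e : OpenPartialHomeomorph M E6} (he : e ∈ IsManifold.maximalAtlas (𝓡 6) ∞ M) (i : Fin 6) :
    LocHs e.target hσ' D fun S => chartCoord e (fun x => a S x • grad g (a' S) x) i := by
  have hΩ := e.open_target
  refine (((h e he).mono (by linarith)).mul (LocHs.sum hΩ Finset.univ fun j _ =>
    (LocHs.smooth hΩ (contDiffOn_chartGram_inv g he i j)).mul
      ((h' e he).fderiv_apply hΩ (stdVec j)) hΩ) hΩ).congr fun S hS y hy => ?_
  rw [← chartCoord_grad g he hy (h'.mdifferentiable hσ' hS _)]
  exact (congrArg (fun w : E6 => w i) (map_smul (mfderiv (𝓡 6) (𝓡 6) e (e.symm y)) _ _)).symm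

lemma diverg_smul_grad (hle : τ + 2 ≤ σ) (h : HsFamily hσ D a) (h' : HsFamily hσ D a') :
    HsFamily hτ D fun S x => diverg g (fun z => a S z • grad g (a' S) z) x := by
  intro e he
  have hΩ := e.open_target
  have hσ' : (Module.finrank ℝ E6 : ℝ) < 2 * (σ - 1) := by linarith
  have hσ'' : (Module.finrank ℝ E6 : ℝ) < 2 * (σ - 1 - 1) := by linarith
  have locHs_field : ∀ e ∈ IsManifold.maximalAtlas (𝓡 6) ∞ M, ∀ i, LocHs e.target hσ' D
      (fun S => chartCoord e (fun x => a S x • grad g (a' S) x) i) := fun e he =>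
    h.locHs_chartCoord_smul_grad g h' he
  have differentiableAt_field : ∀ S ∈ D, ∀ e ∈ IsManifold.maximalAtlas (𝓡 6) ∞ M, ∀ y ∈ e.target,
      DifferentiableAt ℝ (chartField e fun x => a S x • grad g (a' S) x) y :=
    fun S hS e he y hy => differentiableAt_euclidean.2 fun i =>
      (((locHs_field e he i).contDiffOn e.open_target 1 (by simpa using hσ'') hS).contDiffAt
        (e.open_target.mem_nhds hy)).differentiableAt (by simp)
  have contDiffOn_fderiv_gram : ∀ i j k, ContDiffOn ℝ ∞
      (fun y => fderiv ℝ (fun z => chartGram g e z i j) y (stdVec k)) e.target := fun i j k =>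
    ((contDiffOn_chartGram g he i j).fderiv_of_isOpen hΩ (by simp)).clm_apply contDiffOn_const
  have locHs_divergence := LocHs.sum hΩ Finset.univ fun i _ =>
    ((locHs_field e he i).fderiv_apply (hσ' := hσ'') hΩ (stdVec i)).mono (hτ := hτ) (by linarith)
  have locHs_connection := LocHs.sum hΩ Finset.univ fun k _ =>
    (((LocHs.sum hΩ Finset.univ fun i _ => LocHs.sum hΩ Finset.univ fun j _ => LocHs.smooth hΩ
      ((contDiffOn_chartGram_inv g he i j).mul (contDiffOn_fderiv_gram i j k))).const_mul hΩ
      (1 / 2)).mul ((locHs_field e he k).mono (hτ := hτ) (by linarith)) hΩ)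
  exact (locHs_divergence.add locHs_connection).congr fun S hS y hy =>
    (diverg_chart he g (differentiableAt_field S hS) hy).symm

protected lemma lap (hle : τ + 2 ≤ σ) (h : HsFamily hσ D a) :
    HsFamily hτ D fun S => lap g (a S) := by
  have hsFamily_diverg_grad := diverg_smul_grad (hτ := hτ) g hle
    (scalar (M := M) (hσ := hσ) (D := D) (c := fun _ => 1) continuousOn_const) h
  simp only [one_smul] at hsFamily_diverg_grad
  exact hsFamily_diverg_grad

end HsFamily

/-! ### Positivity is an open condition -/

namespace HsFunction

variable {M : Type*} [TopologicalSpace M] [ChartedSpace E6 M] [IsManifold (𝓡 6) ∞ M] {σ : ℝ}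

lemma continuous_eval (hσ : (Module.finrank ℝ E6 : ℝ) < 2 * σ) :
    Continuous fun p : HsFunction M σ × M => p.1 p.2 := by
  rw [continuous_iff_continuousAt]
  rintro ⟨f, x⟩
  have he := IsManifold.chart_mem_maximalAtlas (I := 𝓡 6) (n := ∞) x
  set e := chartAt E6 x
  have hx : x ∈ e.source := mem_chart_source E6 x
  obtain ⟨K, hK, hxK, hKe⟩ := exists_compact_subset e.open_target (e.map_source hx)
  obtain ⟨χ, hχ, hχc, hχe, hχ1, -⟩ := exists_smooth_cutoff hK e.open_target hKe
  let l : Localizer M := ⟨e, he, χ, hχ, hχc, hχe⟩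
  have continuousAt_pair : ContinuousAt
      (fun p : HsFunction M σ × M => (synth hσ (p.1.density l), e p.2)) (f, x) :=
    ((synth hσ).continuous.comp
      ((continuous_density l).comp continuous_fst)).continuousAt.prodMk
      ((e.continuousAt hx).comp (f := Prod.snd) continuousAt_snd)
  have continuousAt_synth : ContinuousAt
      (fun p : HsFunction M σ × M => (synth hσ (p.1.density l) (e p.2)).re) (f, x) :=
    Complex.continuous_re.continuousAt.comp <|
      (ContinuousEval.continuous_eval (F := BoundedContinuousFunction E6 ℂ)).continuousAt.comp
        continuousAt_pair
  have eventually_mem : ∀ᶠ z in 𝓝 x, z ∈ e.source ∧ e z ∈ interior K :=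
    Filter.Eventually.and (e.open_source.mem_nhds hx)
      ((e.continuousAt hx).eventually (isOpen_interior.mem_nhds hxK))
  refine continuousAt_synth.congr ?_
  filter_upwards [continuousAt_snd.eventually eventually_mem] with p hp
  rw [synth_density, Complex.ofReal_re]
  change χ (e p.2) * p.1 (e.symm (e p.2)) = p.1 p.2
  rw [hχ1 _ (interior_subset hp.2), one_mul, e.left_inv hp.1]

lemma eventually_pos [CompactSpace M] (hσ : (Module.finrank ℝ E6 : ℝ) < 2 * σ)
    {f : HsFunction M σ} (hf : ∀ x, 0 < f x) : ∀ᶠ f' in 𝓝 f, ∀ x, 0 < f' x := by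
  simpa using isCompact_univ.eventually_forall_of_forall_eventually (x₀ := f)
    (P := fun (f' : HsFunction M σ) (x : M) => 0 < f' x) fun x _ =>
      (continuous_eval hσ).continuousAt.eventually (lt_mem_nhds (hf x))

end HsFunction

/-! ### The equations solved for the data -/

section Data

variable {M : Type*} [TopologicalSpace M] [ChartedSpace E6 M] [IsManifold (𝓡 6) ∞ M]

/-- The value of `2R - |F₁|²` forced by the second equation. -/
def scalarData (g : SmoothMetric M) (α β : ℝ) (F : DiffForm M 5) (v u : M → ℝ) (x : M) : ℝ :=
  (5 * lap g (fun z => u z ^ 2 * v z) x + 5 * (u x ^ 2 * lap g v x)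
    - 6 * (v x * g.inner x (grad g u x) (grad g u x))
    - u x ^ 2 * (v x)⁻¹ ^ 3 * formNormSq g F x
    - 6 * (α * (u x * v x ^ 2) + β * v x ^ 2)) * (u x ^ 2 * v x)⁻¹

/-- The value of `|F₃|² - 2T` forced by the first equation, once `2R - |F₁|²` is `scalarData`. -/
def stringData (g : SmoothMetric M) (α β : ℝ) (F : DiffForm M 5) (v u : M → ℝ) (x : M) : ℝ :=
  (α * (2 * v x ^ 3) - 10 * (u x * v x * lap g v x)
    - 6 * diverg g (fun z => v z ^ 2 • grad g u z) x
    - u x * (v x)⁻¹ ^ 2 * formNormSq g F x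
    + u x * v x ^ 2 * scalarData g α β F v u x) * (u x)⁻¹

lemma formNormSq_zero (g : SmoothMetric M) (p : ℕ) (x : M) :
    formNormSq g (0 : DiffForm M p) x = 0 :=
  mul_eq_zero_of_right _ <| Finset.sum_eq_zero fun _ _ => Finset.sum_eq_zero fun _ _ =>
    mul_eq_zero_of_right _ rfl

lemma solvesEqMotion_of_data (g : SmoothMetric M) {α β : ℝ} {F : (p : ℕ) → DiffForm M p}
    {R T v u : M → ℝ} (hv : ContMDiff (𝓡 6) 𝓘(ℝ, ℝ) 2 v) (hu : ContMDiff (𝓡 6) 𝓘(ℝ, ℝ) 2 u)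
    (v_pos : ∀ x, 0 < v x) (u_pos : ∀ x, 0 < u x)
    (hF₀ : F 0 = 0) (hF₂ : F 2 = 0) (hF₄ : F 4 = 0) (hF₆ : F 6 = 0)
    (hR : ∀ x, 2 * R x - formNormSq g (F 1) x = scalarData g α β (F 5) v u x)
    (hT : ∀ x, formNormSq g (F 3) x - 2 * T x = stringData g α β (F 5) v u x) :
    SolvesEqMotion g 6 3 α β R F T v u where
  contMDiff_v := hv
  contMDiff_u := hu
  v_pos := v_pos
  u_pos := u_pos
  eq_u x := by
    have cleared := hT x
    rw [stringData, ← hR x, eq_mul_inv_iff_mul_eq₀ (u_pos x).ne'] at cleared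
    have flux_sum : ∑ p ∈ Finset.range 7, v x ^ (3 - (p : ℤ)) * formNormSq g (F p) x
        = v x ^ 2 * formNormSq g (F 1) x + formNormSq g (F 3) x
          + (v x)⁻¹ ^ 2 * formNormSq g (F 5) x := by
      norm_num [Finset.sum_range_succ, hF₀, hF₂, hF₄, hF₆, formNormSq_zero]
    have string_power : v x ^ ((((3 : ℤ) : ℝ) - 3) / 2) = 1 := by norm_num
    rw [flux_sum, string_power]
    linear_combination cleared
  eq_v x := by
    have cleared := hR x
    rw [scalarData, eq_mul_inv_iff_mul_eq₀
      (mul_pos (pow_pos (u_pos x) 2) (v_pos x)).ne'] at cleared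
    have flux_sum : ∑ p ∈ Finset.range 7,
        (3 - (p : ℝ)) * v x ^ (2 - (p : ℤ)) * formNormSq g (F p) x
        = 2 * v x * formNormSq g (F 1) x - 2 * (v x)⁻¹ ^ 3 * formNormSq g (F 5) x := by
      norm_num [Finset.sum_range_succ, hF₀, hF₂, hF₄, hF₆, formNormSq_zero]
      norm_cast
    rw [flux_sum]
    push_cast
    linear_combination -cleared

namespace HsFamily

variable {X : Type*} [TopologicalSpace X] {s σ : ℝ} {hs : (Module.finrank ℝ E6 : ℝ) < 2 * s}
  {hσ : (Module.finrank ℝ E6 : ℝ) < 2 * σ} {D : Set X} {α β : X → ℝ} {F : X → HsForm M 5 s}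
  {v u : X → M → ℝ}

protected lemma scalarData (g : SmoothMetric M) (hle : σ + 2 ≤ s) (hα : ContinuousOn α D)
    (hβ : ContinuousOn β D) (hF : ContinuousOn F D) (hv : HsFamily hs D v) (hu : HsFamily hs D u)
    (v_pos : ∀ S ∈ D, ∀ x, 0 < v S x) (u_pos : ∀ S ∈ D, ∀ x, 0 < u S x) :
    HsFamily hσ D fun S => scalarData g (α S) (β S) (F S).toForm (v S) (u S) := by
  have hs' : (Module.finrank ℝ E6 : ℝ) < 2 * (s - 1) := by linarith
  have hv' : HsFamily hσ D v := hv.mono (by linarith)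
  have hu' : HsFamily hσ D u := hu.mono (by linarith)
  have lap_v : HsFamily hσ D fun S => lap g (v S) := hv.lap g hle
  have lap_sq_mul : HsFamily hσ D fun S => lap g (fun z => u S z ^ 2 * v S z) :=
    ((hu.pow 2).mul hv).lap g hle
  have normSq_grad : HsFamily hσ D fun S x => g.inner x (grad g (u S) x) (grad g (u S) x) :=
    (hu.inner_grad_grad (hσ' := hs') g).mono (by linarith)
  have normSq_form : HsFamily hσ D fun S x => formNormSq g (F S).toForm x :=
    (HsFamily.formNormSq (hσ := hs) g hF).mono (by linarith)
  have constraints := (((scalar hα).mul (hu'.mul (hv'.pow 2))).add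
    ((scalar hβ).mul (hv'.pow 2))).const_mul 6
  exact (((((lap_sq_mul.const_mul 5).add (((hu'.pow 2).mul lap_v).const_mul 5)).sub
    ((hv'.mul normSq_grad).const_mul 6)).sub
    (((hu'.pow 2).mul ((hv'.inv v_pos).pow 3)).mul normSq_form)).sub constraints).mul
    (((hu'.pow 2).mul hv').inv fun S hS x => mul_pos (pow_pos (u_pos S hS x) 2) (v_pos S hS x))

protected lemma stringData (g : SmoothMetric M) (hle : σ + 2 ≤ s) (hα : ContinuousOn α D)
    (hβ : ContinuousOn β D) (hF : ContinuousOn F D) (hv : HsFamily hs D v) (hu : HsFamily hs D u)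
    (v_pos : ∀ S ∈ D, ∀ x, 0 < v S x) (u_pos : ∀ S ∈ D, ∀ x, 0 < u S x) :
    HsFamily hσ D fun S => stringData g (α S) (β S) (F S).toForm (v S) (u S) := by
  have hv' : HsFamily hσ D v := hv.mono (by linarith)
  have hu' : HsFamily hσ D u := hu.mono (by linarith)
  have lap_v : HsFamily hσ D fun S => lap g (v S) := hv.lap g hle
  have diverg_sq_grad : HsFamily hσ D fun S => diverg g (fun z => v S z ^ 2 • grad g (u S) z) :=
    (hv.pow 2).diverg_smul_grad g hle hu
  have normSq_form : HsFamily hσ D fun S x => formNormSq g (F S).toForm x :=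
    (HsFamily.formNormSq (hσ := hs) g hF).mono (by linarith)
  have curvature := (hu'.mul (hv'.pow 2)).mul
    (HsFamily.scalarData (hσ := hσ) g hle hα hβ hF hv hu v_pos u_pos)
  exact ((((((scalar hα).mul ((hv'.pow 3).const_mul 2)).sub
    (((hu'.mul hv').mul lap_v).const_mul 10)).sub (diverg_sq_grad.const_mul 6)).sub
    ((hu'.mul ((hv'.inv v_pos).pow 2)).mul normSq_form)).add curvature).mul (hu'.inv u_pos)

end HsFamily

end Data

section Cone

variable (M : Type*) [TopologicalSpace M] [ChartedSpace E6 M] (s : ℝ)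

/-- The pairs of positive functions of class `H^s`: the `(v, u)` for which the system can be
solved for its data. -/
def positiveCone : Set (HsFunction M s × HsFunction M s) :=
  {p | (∀ x, 0 < p.1 x) ∧ ∀ x, 0 < p.2 x}

variable {s}

lemma positiveCone_mem_nhds_one [IsManifold (𝓡 6) ∞ M] [CompactSpace M]
    (hs : (Module.finrank ℝ E6 : ℝ) < 2 * s) : positiveCone M s ∈ 𝓝 (1, 1) :=
  (continuousAt_fst.eventually (HsFunction.eventually_pos hs fun _ => one_pos)).and
    (continuousAt_snd.eventually (HsFunction.eventually_pos hs fun _ => one_pos))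

end Cone

end

theorem mainTheorem7_general (M : Type*) [TopologicalSpace M] [ChartedSpace E6 M]
    [IsManifold (𝓡 6) ∞ M] (g : SmoothMetric M) (s : ℝ) (hs : 5 < s) :
    ∃ a b : ℝ × ℝ × HsForm M 5 s × HsFunction M s × HsFunction M s → HsFunction M (s - 2),
      ContinuousOn a {S | (S.2.2.2.1, S.2.2.2.2) ∈ positiveCone M s} ∧
      ContinuousOn b {S | (S.2.2.2.1, S.2.2.2.2) ∈ positiveCone M s} ∧
      ∀ (α β : ℝ) (F₅ : HsForm M 5 s) (v u : HsFunction M s), (v, u) ∈ positiveCone M s →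
        ∀ (R T : M → ℝ) (F : (p : ℕ) → DiffForm M p),
          F 0 = 0 → F 2 = 0 → F 4 = 0 → F 6 = 0 → F 5 = F₅.toForm →
          (∀ x, 2 * R x - formNormSq g (F 1) x = a (α, β, F₅, v, u) x) →
          (∀ x, formNormSq g (F 3) x - 2 * T x = b (α, β, F₅, v, u) x) →
          SolvesEqMotion g 6 3 α β R F T v u := by
  set D := {S : ℝ × ℝ × HsForm M 5 s × HsFunction M s × HsFunction M s |
    (S.2.2.2.1, S.2.2.2.2) ∈ positiveCone M s}
  have hs₀ : (Module.finrank ℝ E6 : ℝ) < 2 * s := by simp; linarith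
  have hs₂ : (Module.finrank ℝ E6 : ℝ) < 2 * (s - 2) := by simp; linarith
  have hα : ContinuousOn (fun S => S.1) D := by fun_prop
  have hβ : ContinuousOn (fun S => S.2.1) D := by fun_prop
  have hF : ContinuousOn (fun S => S.2.2.1) D := by fun_prop
  have hv : HsFamily hs₀ D fun S => S.2.2.2.1 := .of_continuousOn (by fun_prop)
  have hu : HsFamily hs₀ D fun S => S.2.2.2.2 := .of_continuousOn (by fun_prop)
  obtain ⟨a, continuousOn_a, a_eq⟩ := (HsFamily.scalarData (hσ := hs₂) g (by linarith) hα hβ hF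
    hv hu (fun S hS => hS.1) fun S hS => hS.2).exists_hsFunction
  obtain ⟨b, continuousOn_b, b_eq⟩ := (HsFamily.stringData (hσ := hs₂) g (by linarith) hα hβ hF
    hv hu (fun S hS => hS.1) fun S hS => hS.2).exists_hsFunction
  refine ⟨a, b, continuousOn_a, continuousOn_b,
    fun α β F₅ v u pos R T F hF₀ hF₂ hF₄ hF₆ hF₅ hR hT => ?_⟩
  have mem : (α, β, F₅, v, u) ∈ D := pos
  exact solvesEqMotion_of_data g (hv.contMDiff 2 hs₂ mem) (hu.contMDiff 2 hs₂ mem) pos.1 pos.2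
    hF₀ hF₂ hF₄ hF₆ (fun x => by rw [hR, a_eq _ mem, hF₅]) fun x => by rw [hT, b_eq _ mem, hF₅]

theorem mainTheorem7 (M : Type*) [TopologicalSpace M] [ChartedSpace E6 M]
    [IsManifold (𝓡 6) ∞ M] [T2Space M] [CompactSpace M]
    (g : SmoothMetric M) (s : ℝ) (hs : 5 < s) :
    ∃ N ∈ 𝓝 ((1, 1) : HsFunction M s × HsFunction M s),
    ∃ a b : ℝ × ℝ × HsForm M 5 s × HsFunction M s × HsFunction M s → HsFunction M (s - 2),
      ContinuousOn a {S | (S.2.2.2.1, S.2.2.2.2) ∈ N} ∧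
      ContinuousOn b {S | (S.2.2.2.1, S.2.2.2.2) ∈ N} ∧
      ∀ (α β : ℝ) (F₅ : HsForm M 5 s) (v u : HsFunction M s), (v, u) ∈ N →
        ∀ (R T : M → ℝ) (F : (p : ℕ) → DiffForm M p),
          F 0 = 0 → F 2 = 0 → F 4 = 0 → F 6 = 0 → F 5 = F₅.toForm →
          (∀ x, 2 * R x - formNormSq g (F 1) x = a (α, β, F₅, v, u) x) →
          (∀ x, formNormSq g (F 3) x - 2 * T x = b (α, β, F₅, v, u) x) →
          SolvesEqMotion g 6 3 α β R F T v u :=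
  ⟨positiveCone M s, positiveCone_mem_nhds_one M (by simp; linarith), mainTheorem7_general M g s hs⟩
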